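/- Let $m\ge 1$ and let $n_1,\dots,n_m$ be positive integers; put $n=n_1+\dots+n_m$ and $e=\sum_{1\le i<j\le m} n_i n_j$, and assume $n\ge 2$. For a finite graph $G$, let the $4$-girth-thickness $\theta(4,G)$ be the smallest number of planar subgraphs of $G$ of girth at least $4$ (the girth is the length of a shortest cycle, and is $\infty$ for an acyclic graph) that together contain every edge of $G$; it is $0$ if $G$ has no edges. Then the complete $m$-partite graph $G=K_{2n_1,2n_2,\dots,2n_m}$, whose parts have sizes $2n_1,\dots,2n_m$, satisfies \[ \theta(4,G)=\left\lceil \frac{e}{n-1}\right\rceil . \] -/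

import Mathlib

namespace SimpleGraph

/-- A drawing of a graph `G` in the Euclidean plane without crossings: vertices are distinct
points, every edge is a simple continuous arc joining the points of its two ends, no arc meets a
vertex except at its own endpoints, and two different arcs can meet only at common endpoints. -/
structure PlaneDrawing {V : Type*} (G : SimpleGraph V) where
  /-- the point representing a vertex -/
  point : V → EuclideanSpace ℝ (Fin 2)
  /-- a parametrization of the arc representing an edge -/
  arc : G.edgeSet → unitInterval → EuclideanSpace ℝ (Fin 2)
  point_injective : Function.Injective point
  arc_continuous : ∀ e, Continuous (arc e)
  arc_injective : ∀ e, Function.Injective (arc e)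
  arc_ends : ∀ e : G.edgeSet, Sym2.map point (e : Sym2 V) = s(arc e 0, arc e 1)
  arc_vertex : ∀ e v t, arc e t = point v → t = 0 ∨ t = 1
  arc_disjoint : ∀ e e', e ≠ e' → ∀ t t', arc e t = arc e' t' →
    (t = 0 ∨ t = 1) ∧ (t' = 0 ∨ t' = 1)

/-- A graph is planar if it can be drawn in the plane without crossings. -/
def IsPlanar {V : Type*} (G : SimpleGraph V) : Prop :=
  Nonempty G.PlaneDrawing

/-- The graph `G` is the union of `k` planar subgraphs of girth at least `g`. Subgraphs are taken
on the whole vertex set, since isolated vertices affect neither planarity nor girth; the girth of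
an acyclic graph is `⊤`. -/
def IsUnionOfPlanarGirth {V : Type*} (g : ℕ∞) (G : SimpleGraph V) (k : ℕ) : Prop :=
  ∃ H : Fin k → SimpleGraph V,
    (∀ i, H i ≤ G ∧ (H i).IsPlanar ∧ g ≤ (H i).egirth) ∧ ⨆ i, H i = G

/-- The `g`-girth-thickness of `G`: the least number of planar subgraphs of girth at least `g`
whose union is `G` (`⊤` if no finite number suffices). -/
noncomputable def girthThickness {V : Type*} (g : ℕ∞) (G : SimpleGraph V) : ℕ∞ :=
  ⨅ (k : ℕ) (_ : G.IsUnionOfPlanarGirth g k), (k : ℕ∞)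

end SimpleGraph

/-! Lower bound: by Euler's formula a planar graph of girth at least 4 on `2n` vertices has at most
`4(n-1)` edges, while `G` has `4e` edges, so `k` such subgraphs need `e ≤ k(n-1)`
(`IsPlanar.ncard_edgeSet_add_four_le`).

Upper bound: `G` arises from `K = K_{n_1,...,n_m}` by doubling every vertex. With `k = ⌈e/(n-1)⌉`,
Nash-Williams' theorem (`exists_isAcyclic_iSup_eq`) splits `K` into `k` forests; its density
condition need only be checked on the full vertex set (`crossPairs_le_of_univ`). Doubling the
vertices of a forest creates no triangle and keeps the graph planar (`IsAcyclic.isPlanar_comap`),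
since the doubled forest has a two-page book embedding.

Arcs are merely continuous, so the Euler bound rests on plane topology, treated through continuous
logarithms of nonvanishing functions. A drawn forest does not separate the plane; an edge joining
already connected vertices splits a face; at most two faces lie along an edge. If there are at least
two faces, each has at least four edges along it, because fewer edges form a forest. Double counting
face-edge incidences gives the bound.

Nash-Williams' theorem is obtained from an exchange argument for colourings of vectors by
independent sets, applied to edge vectors over the field with two elements. -/

section

/-! ### Continuous logarithms in the plane. -/

open Complex Set Topology

/-- A subset of the plane on which every continuous nowhere vanishing function has a continuous
logarithm. -/
def HasLog (K : Set ℂ) : Prop :=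
  ∀ f : ℂ → ℂ, ContinuousOn f K → (∀ z ∈ K, f z ≠ 0) →
    ∃ g : ℂ → ℂ, ContinuousOn g K ∧ ∀ z ∈ K, exp (g z) = f z

lemma IsPreconnected.eq_of_exp_eq {X : Type*} [TopologicalSpace X] {s : Set X}
    (hs : IsPreconnected s) {f : X → ℂ} (hf : ContinuousOn f s) {c : ℂ}
    (hc : ∀ x ∈ s, exp (f x) = c) {x y : X} (hx : x ∈ s) (hy : y ∈ s) : f x = f y := by
  have : PreconnectedSpace s := isPreconnected_iff_preconnectedSpace.mp hs
  exact isCoveringMap_exp.const_of_comp (continuousOn_iff_continuous_domRestrict.mp hf)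
    (fun a a' => by ext; simp [domRestrict, hc a.1 a.2, hc a'.1 a'.2]) ⟨x, hx⟩ ⟨y, hy⟩

lemma JoinedIn.eq_of_exp_eq {X : Type*} [TopologicalSpace X] {s : Set X} {x y : X}
    (h : JoinedIn s x y) {f : X → ℂ} (hf : ContinuousOn f s) {c : ℂ}
    (hc : ∀ x ∈ s, exp (f x) = c) : f x = f y := by
  obtain ⟨γ, hγ⟩ := h
  have hsub : range γ ⊆ s := range_subset_iff.mpr hγ
  exact (isPreconnected_range γ.continuous).eq_of_exp_eq (hf.mono hsub)
    (fun z hz => hc z (hsub hz)) ⟨0, γ.source⟩ ⟨1, γ.target⟩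

lemma exists_continuous_log_of_homotopy {X : Type*} [TopologicalSpace X]
    (H : unitInterval × X → ℂ) (hH : Continuous H) (h0 : ∀ p, H p ≠ 0)
    (h1 : ∀ x, H (0, x) = 1) :
    ∃ g : X → ℂ, Continuous g ∧ ∀ x, exp (g x) = H (1, x) := by
  let H' : C(unitInterval × X, {z : ℂ // z ≠ 0}) :=
    ⟨fun p => ⟨H p, h0 p⟩, hH.subtype_mk _⟩
  have H_0 : ∀ a, H' (0, a) = (⟨_, (0 : ℂ).exp_ne_zero⟩ : {z : ℂ // z ≠ 0}) := fun a => by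
    ext; simp [H', h1]
  let L := isCoveringMap_exp.liftHomotopy H' (.const X (0 : ℂ)) H_0
  refine ⟨fun x => L (1, x), by fun_prop, fun x => ?_⟩
  have := congr_fun (isCoveringMap_exp.liftHomotopy_lifts H' (.const X (0 : ℂ)) H_0) (1, x)
  exact congrArg Subtype.val this

/-- Moving `w` from `p` to `q` inside `F` deforms the constant 1 into the quotient through `(z - w)
/ (z - p)`, which has neither zeros nor poles off `F`; the homotopy lifts through `exp`. -/
lemma JoinedIn.exists_log_div {F : Set ℂ} {p q : ℂ} (h : JoinedIn F p q) :
    ∃ g : ℂ → ℂ, ContinuousOn g Fᶜ ∧ ∀ z ∈ Fᶜ, exp (g z) = (z - q) / (z - p) := by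
  classical
  obtain ⟨γ, hγ⟩ := h
  have hp : p ∈ F := by simpa using hγ 0
  have hne : ∀ (z : (Fᶜ : Set ℂ)) (w : ℂ), w ∈ F → (z : ℂ) - w ≠ 0 := fun z w hw h0 =>
    z.2 (by rwa [sub_eq_zero.mp h0])
  obtain ⟨g, hg, hg'⟩ := exists_continuous_log_of_homotopy
    (fun x : unitInterval × (Fᶜ : Set ℂ) => ((x.2 : ℂ) - γ x.1) / (x.2 - p))
    (by
      refine Continuous.div (by fun_prop) (by fun_prop) fun x => hne x.2 p hp)
    (fun x => div_ne_zero (hne _ _ (hγ _)) (hne _ _ hp))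
    (fun x => by simp [div_self (hne x p hp)])
  refine ⟨fun z => if hz : z ∈ Fᶜ then g ⟨z, hz⟩ else 0, ?_, fun z hz => ?_⟩
  · rw [continuousOn_iff_continuous_domRestrict]
    convert hg using 1
    ext z
    simp only [domRestrict_apply, Subtype.coe_prop, dite_true]
  · beta_reduce
    rw [dif_pos hz, hg']
    simp

lemma hasLog_univ : HasLog univ := by
  intro f hf h0
  rw [continuousOn_univ] at hf
  obtain ⟨g, hg, hg'⟩ := exists_continuous_log_of_homotopy
    (fun x : unitInterval × ℂ => f ((x.1 : ℝ) * x.2) / f 0) (by fun_prop (disch := simp [h0]))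
    (fun x => div_ne_zero (h0 _ trivial) (h0 _ trivial)) (fun x => by simp [h0])
  refine ⟨fun z => g z + log (f 0), by fun_prop, fun z _ => ?_⟩
  rw [exp_add, hg', exp_log (h0 _ trivial)]
  simp [h0]

/-- The arc contracts to `γ 0` along its parameter, which yields a logarithm in the parameter; it is
carried back to the image because `γ` is an embedding. -/
lemma hasLog_range_arc {γ : unitInterval → ℂ} (hγ : Continuous γ) (hi : Function.Injective γ) :
    HasLog (range γ) := by
  intro f hf h0
  have hfγ : Continuous (f ∘ γ) := hf.comp_continuous hγ fun t => ⟨t, rfl⟩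
  have h0' : ∀ t, f (γ t) ≠ 0 := fun t => h0 _ ⟨t, rfl⟩
  obtain ⟨g, hg, hg'⟩ := exists_continuous_log_of_homotopy
    (fun x : unitInterval × unitInterval => (f ∘ γ) (x.1 * x.2) / f (γ 0))
    (by
      refine Continuous.div_const (hfγ.comp ?_) _
      fun_prop) (fun x => div_ne_zero (h0' _) (h0' _))
    (fun x => by simp [h0'])
  let e := (hγ.isClosedEmbedding hi).isEmbedding.toHomeomorph
  refine ⟨Function.extend γ (fun t => g t + log (f (γ 0))) 0, ?_, ?_⟩
  · rw [continuousOn_iff_continuous_domRestrict]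
    have : (range γ).domRestrict (Function.extend γ (fun t => g t + log (f (γ 0))) 0) =
        (fun t => g t + log (f (γ 0))) ∘ e.symm := by
      ext ⟨_, t, rfl⟩
      have : e.symm ⟨γ t, t, rfl⟩ = t := by
        rw [Homeomorph.symm_apply_eq]; rfl
      simp only [domRestrict_apply, Function.comp_apply, this, hi.extend_apply]
    rw [this]
    fun_prop
  · rintro _ ⟨t, rfl⟩
    rw [hi.extend_apply, exp_add, hg', exp_log (h0' _)]
    simp [h0']

/-- An integral power of a translation, prescribed near infinity, does not extend to a nowhere
vanishing continuous function on the plane. -/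
lemma eq_zero_of_eq_zpow_near_infinity {G : ℂ → ℂ} (hG : Continuous G) (h0 : ∀ z, G z ≠ 0)
    {R : ℝ} {a : ℂ} {k : ℤ} (h : ∀ z, R ≤ ‖z‖ → G z = (z - a) ^ k) : k = 0 := by
  obtain ⟨g, hg, hg'⟩ := hasLog_univ G hG.continuousOn fun z _ => h0 z
  rw [continuousOn_univ] at hg
  -- The circle of radius `r` about `a` lies where the formula for `G` holds. Along it the logarithm
  -- increases by `2πik`, yet it returns to its initial value.
  set r : ℝ := |R| + ‖a‖ + 1
  have hr : 0 < r := by positivity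
  have key : ∀ θ : ℝ, exp (g (a + r * exp (θ * I)) - k * (θ * I)) = (r : ℂ) ^ k := by
    intro θ
    rw [exp_sub, hg' _ trivial, h, add_sub_cancel_left, mul_zpow, ← exp_int_mul,
      mul_div_cancel_right₀ _ (exp_ne_zero _)]
    have h1 : ‖(r : ℂ) * exp (θ * I)‖ = r := by
      rw [norm_mul, norm_exp_ofReal_mul_I, mul_one, Complex.norm_real, Real.norm_of_nonneg hr.le]
    have h2 := norm_sub_norm_le ((r : ℂ) * exp (θ * I)) (-a)
    rw [h1, norm_neg, sub_neg_eq_add, add_comm _ a] at h2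
    linarith [le_abs_self R]
  have := isPreconnected_univ.eq_of_exp_eq (X := ℝ)
    (f := fun θ : ℝ => g (a + r * exp (θ * I)) - k * (θ * I)) (by fun_prop)
    (fun θ _ => key θ) (mem_univ 0) (mem_univ (2 * Real.pi))
  simp only [ofReal_zero, zero_mul, exp_zero, mul_one, mul_zero, sub_zero, ofReal_mul,
    ofReal_ofNat, exp_two_pi_mul_I] at this
  have h3 : (k : ℂ) * (2 * Real.pi * I) = 0 := by linear_combination this
  simpa [Real.pi_ne_zero] using h3

end

/-! ### Gluing logarithms; sets with logarithms do not separate the plane. -/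

section

open Complex Set Topology

lemma exists_continuousOn_union {A B : Set ℂ} (hA : IsClosed A) (hB : IsClosed B) {g h : ℂ → ℂ}
    (hg : ContinuousOn g A) (hh : ContinuousOn h B) (hgh : ∀ z ∈ A, z ∈ B → g z = h z) :
    ∃ f : ℂ → ℂ, ContinuousOn f (A ∪ B) ∧ EqOn f g A ∧ EqOn f h B := by
  classical
  have h1 : EqOn (A.piecewise g h) g A := fun z hz => by simp [hz]
  have h2 : EqOn (A.piecewise g h) h B := fun z hz => by
    by_cases hzA : z ∈ A
    · simp [hzA, hgh z hzA hz]
    · simp [hzA]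
  exact ⟨A.piecewise g h, (hg.congr h1).union_of_isClosed (hh.congr h2) hA hB, h1, h2⟩

/-- With at most one common point, the two logarithms agree on the intersection once one of them is
shifted by a period of `exp`. -/
lemma HasLog.union {A B : Set ℂ} (hA : IsClosed A) (hB : IsClosed B) (hlA : HasLog A)
    (hlB : HasLog B) (hAB : (A ∩ B).Subsingleton) : HasLog (A ∪ B) := by
  intro f hf h0
  obtain ⟨g, hg, hg'⟩ := hlA f (hf.mono subset_union_left) fun z hz => h0 z (.inl hz)
  obtain ⟨h, hh, hh'⟩ := hlB f (hf.mono subset_union_right) fun z hz => h0 z (.inr hz)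
  obtain ⟨c, hc, hc'⟩ : ∃ c, exp c = 1 ∧ ∀ z ∈ A, z ∈ B → g z = h z + c := by
    by_cases hp : (A ∩ B).Nonempty
    · obtain ⟨p, hpA, hpB⟩ := hp
      refine ⟨g p - h p, ?_, fun z hzA hzB => ?_⟩
      · rw [exp_sub, hg' p hpA, hh' p hpB, div_self (h0 p (.inl hpA))]
      · rw [hAB ⟨hzA, hzB⟩ ⟨hpA, hpB⟩]; ring
    · exact ⟨0, exp_zero, fun z hzA hzB => (hp ⟨z, hzA, hzB⟩).elim⟩
  obtain ⟨k, hk, h1, h2⟩ := exists_continuousOn_union hA hB hg (hh.add_const c) hc'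
  refine ⟨k, hk, ?_⟩
  rintro z (hz | hz)
  · rw [h1 hz, hg' z hz]
  · rw [h2 hz, exp_add, hc, mul_one, hh' z hz]

lemma HasLog.of_union {A B : Set ℂ} (hA : IsClosed A) (hB : IsClosed B) (h : HasLog (A ∪ B))
    (hAB : Disjoint A B) : HasLog A := by
  intro f hf h0
  obtain ⟨f', hf', h1, h2⟩ := exists_continuousOn_union hA hB hf
    (continuousOn_const (c := (1 : ℂ))) fun z hzA hzB => (hAB.le_bot ⟨hzA, hzB⟩).elim
  obtain ⟨g, hg, hg'⟩ := h f' hf' (by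
    rintro z (hz | hz)
    · rw [h1 hz]; exact h0 z hz
    · rw [h2 hz]; exact one_ne_zero)
  exact ⟨g, hg.mono subset_union_left, fun z hz => by rw [hg' z (.inl hz), h1 hz]⟩

lemma hasLog_of_finite {A : Set ℂ} (hA : A.Finite) : HasLog A := fun f _ h0 =>
  ⟨fun z => log (f z), hA.continuousOn _, fun z hz => exp_log (h0 z hz)⟩

/-- Two functions with logarithms on each of two closed sets meeting in two points satisfy a
multiplicative relation up to a function with a logarithm on the union. -/
lemma exists_log_zpow_mul_zpow {A B : Set ℂ} (hA : IsClosed A) (hB : IsClosed B) {p q : ℂ}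
    (hpA : p ∈ A) (hpB : p ∈ B) (hqA : q ∈ A) (hqB : q ∈ B) (hAB : A ∩ B ⊆ {p, q})
    {f g h : Fin 2 → ℂ → ℂ} (hg : ∀ i, ContinuousOn (g i) A) (hh : ∀ i, ContinuousOn (h i) B)
    (hg' : ∀ i, ∀ z ∈ A, exp (g i z) = f i z) (hh' : ∀ i, ∀ z ∈ B, exp (h i z) = f i z) :
    ∃ k : Fin 2 → ℤ, k ≠ 0 ∧ ∃ G : ℂ → ℂ, ContinuousOn G (A ∪ B) ∧
      ∀ z ∈ A ∪ B, exp (G z) = f 0 z ^ k 0 * f 1 z ^ k 1 := by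
  have hm : ∀ z ∈ A, z ∈ B → ∀ i, ∃ m : ℤ, g i z = h i z + m * (2 * Real.pi * I) :=
    fun z hzA hzB i => exp_eq_exp_iff_exists_int.mp (by rw [hg' i z hzA, hh' i z hzB])
  choose m hm using hm p hpA hpB
  choose m' hm' using ‹∀ z ∈ A, z ∈ B → _› q hqA hqB
  -- For each function the two logarithms differ by `m` periods at `p` and by `m'` at `q`. One
  -- integer equation in two unknowns has a nonzero solution `k`, and for this combination the
  -- discrepancy is the same at both points, so a single shift removes it.
  obtain ⟨k, hk0, hk⟩ : ∃ k : Fin 2 → ℤ, k ≠ 0 ∧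
      k 0 * (m 0 - m' 0) + k 1 * (m 1 - m' 1) = 0 := by
    by_cases h0 : m 0 - m' 0 = 0
    · exact ⟨![1, 0], fun h => by simpa using congrFun h 0, by simp [h0]⟩
    · refine ⟨![m 1 - m' 1, -(m 0 - m' 0)], fun h => h0 ?_, by simp; ring⟩
      have := congrFun h 1
      simp only [Matrix.cons_val_one, Matrix.cons_val_fin_one, Pi.zero_apply] at this
      linarith
  have hk' : (k 0 * (m 0 - m' 0) + k 1 * (m 1 - m' 1) : ℂ) = 0 := by exact_mod_cast hk
  obtain ⟨G, hG, h1, h2⟩ := exists_continuousOn_union hA hB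
    (g := fun z => k 0 * g 0 z + k 1 * g 1 z)
    (h := fun z => k 0 * h 0 z + k 1 * h 1 z + (k 0 * m 0 + k 1 * m 1 : ℤ) * (2 * Real.pi * I))
    (((hg 0).const_mul _).add ((hg 1).const_mul _))
    ((((hh 0).const_mul _).add ((hh 1).const_mul _)).add_const _) (by
      intro z hzA hzB
      obtain rfl | rfl := hAB ⟨hzA, hzB⟩
      · rw [hm, hm]; push_cast; ring
      · rw [hm', hm']; push_cast; linear_combination -(2 * Real.pi * I) * hk')
  refine ⟨k, hk0, G, hG, ?_⟩
  rintro z (hz | hz)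
  · rw [h1 hz, exp_add, exp_int_mul, exp_int_mul, hg' 0 z hz, hg' 1 z hz]
  · rw [h2 hz, exp_add, exp_add, exp_int_mul, exp_int_mul, hh' 0 z hz, hh' 1 z hz,
      exp_int_mul_two_pi_mul_I, mul_one]

/-- Extend `g` by Tietze and replace `(z - a) ^ k` on `U` by `exp g * R`. The pieces agree on the
frontier, and the result vanishes nowhere although it is `(z - a) ^ k` near infinity. -/
lemma eq_zero_of_zpow_extends {K U : Set ℂ} (hK : IsClosed K)
    (hb : Bornology.IsBounded U) (hf : frontier U ⊆ K) {a : ℂ} (ha : a ∈ interior U) {k : ℤ}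
    {g R : ℂ → ℂ} (hg : ContinuousOn g K) (hR : ContinuousOn R (closure U))
    (hR0 : ∀ z ∈ closure U, R z ≠ 0) (heq : ∀ z ∈ K, exp (g z) * R z = (z - a) ^ k) :
    k = 0 := by
  classical
  obtain ⟨G, hG⟩ := ContinuousMap.exists_restrict_eq hK
    ⟨K.domRestrict g, continuousOn_iff_continuous_domRestrict.mp hg⟩
  have hG' : ∀ z ∈ K, G z = g z := fun z hz => congrArg (fun φ => φ ⟨z, hz⟩) hG
  have hane : ∀ z ∈ closure Uᶜ, z - a ≠ 0 := by
    intro z hz h0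
    rw [closure_compl, sub_eq_zero.mp h0] at hz
    exact hz ha
  obtain ⟨r, hr⟩ := hb.subset_ball 0
  refine eq_zero_of_eq_zpow_near_infinity
    (G := U.piecewise (fun z => exp (G z) * R z) fun z => (z - a) ^ k) (R := r) (a := a) ?_ ?_ ?_
  · refine continuous_piecewise (fun z hz => ?_) ?_ ?_
    · rw [hG' z (hf hz), heq z (hf hz)]
    · exact (by fun_prop : Continuous fun z => exp (G z)).continuousOn.mul hR
    · exact ContinuousOn.zpow₀ (by fun_prop) _ fun z hz => .inl (hane z hz)
  · intro z
    by_cases hz : z ∈ U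
    · simp only [hz, piecewise_eq_of_mem]
      exact mul_ne_zero (exp_ne_zero _) (hR0 z (subset_closure hz))
    · simp only [hz, not_false_eq_true, piecewise_eq_of_notMem]
      exact zpow_ne_zero _ (hane z (subset_closure hz))
  · intro z hz
    have : z ∉ U := fun h => by simpa using (mem_ball_zero_iff.mp (hr h)).trans_le hz
    simp [this]

lemma frontier_pathComponentIn_subset {K : Set ℂ} (hK : IsClosed K) (a : ℂ) :
    frontier (pathComponentIn Kᶜ a) ⊆ K := by
  intro x hx
  by_contra hxK
  have ho := hK.isOpen_compl.pathComponentIn a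
  rw [ho.frontier_eq] at hx
  obtain ⟨y, hy, hy'⟩ := mem_closure_iff.mp hx.1 _ (hK.isOpen_compl.pathComponentIn x)
    (mem_pathComponentIn_self hxK)
  exact hx.2 (JoinedIn.trans hy' (JoinedIn.symm hy))

lemma joinedIn_of_norm_lt {R : ℝ} {a b : ℂ} (ha : R < ‖a‖) (hb : R < ‖b‖) :
    JoinedIn {z : ℂ | R < ‖z‖} a b := by
  -- For `R ≤ 0`, either `R` can be raised to half the smaller norm, or one point is 0, which forces
  -- `R < 0` and makes the set the whole plane. For `R > 0` the exterior is the image of a half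
  -- plane under `exp`.
  wlog hR : 0 < R generalizing R
  · have : 0 < min ‖a‖ ‖b‖ ∨ ‖a‖ = 0 ∨ ‖b‖ = 0 := by
      rcases (norm_nonneg a).eq_or_lt' with h | h
      · exact .inr (.inl h)
      · rcases (norm_nonneg b).eq_or_lt' with h' | h'
        · exact .inr (.inr h')
        · exact .inl (lt_min h h')
    rcases this with h | h
    · refine (this (R := min ‖a‖ ‖b‖ / 2) ?_ ?_ (by linarith)).mono fun z hz => ?_
      · linarith [min_le_left ‖a‖ ‖b‖]
      · linarith [min_le_right ‖a‖ ‖b‖]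
      · have : min ‖a‖ ‖b‖ / 2 < ‖z‖ := hz
        show R < ‖z‖
        linarith
    · have hR' : R < 0 := by rcases h with h | h <;> linarith
      have : {z : ℂ | R < ‖z‖} = univ := eq_univ_of_forall fun z => hR'.trans_le (norm_nonneg z)
      rw [this]
      exact isPathConnected_univ.joinedIn _ trivial _ trivial
  · have hpc : IsPathConnected (exp '' {z : ℂ | Real.log R < z.re}) := by
      refine ((convex_halfSpace_re_gt _).isPathConnected ⟨(Real.log R + 1 : ℝ), ?_⟩).image
        continuous_exp
      simp only [mem_ofPred_eq, ofReal_re]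
      linarith
    have hmem : ∀ z : ℂ, R < ‖z‖ → z ∈ exp '' {z : ℂ | Real.log R < z.re} := fun z hz =>
      ⟨log z, by simpa [log_re] using Real.log_lt_log hR hz,
        exp_log (norm_pos_iff.mp (hR.trans hz))⟩
    refine (hpc.joinedIn a (hmem a ha) b (hmem b hb)).mono ?_
    rintro _ ⟨z, hz, rfl⟩
    simpa [norm_exp] using (Real.log_lt_iff_lt_exp hR).mp hz

lemma isBounded_pathComponentIn_or {K : Set ℂ} (hK : IsCompact K) {a b : ℂ}
    (hab : ¬ JoinedIn Kᶜ a b) :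
    Bornology.IsBounded (pathComponentIn Kᶜ a) ∨ Bornology.IsBounded (pathComponentIn Kᶜ b) := by
  obtain ⟨R, hR⟩ := hK.isBounded.subset_closedBall 0
  have hsub : {z : ℂ | R < ‖z‖} ⊆ Kᶜ := fun z hz hzK => by
    have := mem_closedBall_zero_iff.mp (hR hzK)
    exact absurd hz (not_lt.mpr this)
  have key : ∀ c, ¬ Bornology.IsBounded (pathComponentIn Kᶜ c) →
      ∃ z, R < ‖z‖ ∧ JoinedIn Kᶜ c z := by
    intro c hc
    by_contra! h
    have hs : pathComponentIn Kᶜ c ⊆ Metric.closedBall 0 R := fun z hz => by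
      rw [mem_closedBall_zero_iff]
      exact not_lt.mp fun h' => h z h' hz
    exact hc (Metric.isBounded_closedBall.subset hs)
  by_contra! h
  obtain ⟨x, hx, hx'⟩ := key a h.1
  obtain ⟨y, hy, hy'⟩ := key b h.2
  exact hab (hx'.trans (((joinedIn_of_norm_lt hx hy).mono hsub).trans hy'.symm))

/-- Borsuk's criterion: a logarithm of `z - c` on `K` prevents `c` from lying in a bounded component
of the complement, and at most one component is unbounded. -/
lemma HasLog.joinedIn_compl {K : Set ℂ} (hK : IsCompact K) (hl : HasLog K) {a b : ℂ}
    (ha : a ∉ K) (hb : b ∉ K) : JoinedIn Kᶜ a b := by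
  have key : ∀ c, c ∉ K → ¬ Bornology.IsBounded (pathComponentIn Kᶜ c) := by
    intro c hc hbd
    obtain ⟨g, hg, hg'⟩ := hl (fun z => z - c) (by fun_prop) fun z hz h0 =>
      hc (by rwa [← sub_eq_zero.mp h0])
    refine one_ne_zero (eq_zero_of_zpow_extends hK.isClosed hbd
      (frontier_pathComponentIn_subset hK.isClosed c) (k := 1) (a := c) (g := g) (R := fun _ => 1)
      ?_ hg (by fun_prop) (by simp) (fun z hz => by simp [hg' z hz]))
    rw [(hK.isClosed.isOpen_compl.pathComponentIn c).interior_eq]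
    exact mem_pathComponentIn_self hc
  by_contra h
  exact (isBounded_pathComponentIn_or hK h).elim (key a ha) (key b hb)

end

/-! ### Drawings as compact subsets of the complex plane; drawn forests have logarithms. -/

section

open Complex Set Topology

namespace SimpleGraph.PlaneDrawing

variable {V : Type*} {G : SimpleGraph V} (D : G.PlaneDrawing)

/-- The position of a vertex as a complex number. -/
noncomputable def pt (v : V) : ℂ :=
  Complex.orthonormalBasisOneI.repr.symm (D.point v)

/-- The arc of an edge as a path in the complex plane. -/
noncomputable def curve (e : G.edgeSet) (t : unitInterval) : ℂ :=
  Complex.orthonormalBasisOneI.repr.symm (D.arc e t)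

/-- The trace in the complex plane of an edge; empty for non-edges. -/
def trace (e : Sym2 V) : Set ℂ := ⋃ h : e ∈ G.edgeSet, range (D.curve ⟨e, h⟩)

/-- The union of all vertices and of the edges in `S`. -/
def carrier (S : Set (Sym2 V)) : Set ℂ := range D.pt ∪ ⋃ e ∈ S, D.trace e

lemma pt_injective : Function.Injective D.pt :=
  (LinearIsometryEquiv.injective _).comp D.point_injective

lemma continuous_curve (e : G.edgeSet) : Continuous (D.curve e) :=
  (LinearIsometryEquiv.continuous _).comp (D.arc_continuous e)

lemma curve_injective (e : G.edgeSet) : Function.Injective (D.curve e) :=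
  (LinearIsometryEquiv.injective _).comp (D.arc_injective e)

lemma trace_eq (e : G.edgeSet) : D.trace e = range (D.curve e) := by
  simp [trace]

lemma trace_eq_empty {e : Sym2 V} (he : e ∉ G.edgeSet) : D.trace e = ∅ := by
  simp [trace, he]

lemma map_pt (e : G.edgeSet) : Sym2.map D.pt e = s(D.curve e 0, D.curve e 1) := by
  have := congrArg (Sym2.map Complex.orthonormalBasisOneI.repr.symm) (D.arc_ends e)
  rw [Sym2.map_map, Sym2.map_mk] at this
  exact this

lemma curve_eq_curve {e e' : G.edgeSet} (hne : e ≠ e') {t t' : unitInterval}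
    (h : D.curve e t = D.curve e' t') : (t = 0 ∨ t = 1) ∧ (t' = 0 ∨ t' = 1) :=
  D.arc_disjoint e e' hne t t' ((LinearIsometryEquiv.injective _) h)

lemma curve_eq_pt {e : G.edgeSet} {v : V} {t : unitInterval} (h : D.curve e t = D.pt v) :
    t = 0 ∨ t = 1 :=
  D.arc_vertex e v t ((LinearIsometryEquiv.injective _) h)

lemma exists_curve_eq_pt {e : G.edgeSet} {t : unitInterval} (ht : t = 0 ∨ t = 1) :
    ∃ v ∈ (e : Sym2 V), D.curve e t = D.pt v := by
  have h : D.curve e t ∈ Sym2.map D.pt e := by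
    rw [map_pt]; rcases ht with rfl | rfl <;> simp
  obtain ⟨v, hv, h'⟩ := Sym2.mem_map.mp h
  exact ⟨v, hv, h'.symm⟩

lemma mem_of_pt_mem_trace {e : Sym2 V} {v : V} (h : D.pt v ∈ D.trace e) : v ∈ e := by
  obtain ⟨he, t, ht⟩ := mem_iUnion.mp h
  obtain ⟨w, hw, hw'⟩ := D.exists_curve_eq_pt (D.curve_eq_pt ht)
  rw [ht] at hw'
  rwa [D.pt_injective hw']

lemma pt_mem_trace {e : Sym2 V} (he : e ∈ G.edgeSet) {v : V} (h : v ∈ e) :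
    D.pt v ∈ D.trace e := by
  have : D.pt v ∈ Sym2.map D.pt e := Sym2.mem_map.mpr ⟨v, h, rfl⟩
  rw [D.map_pt ⟨e, he⟩, Sym2.mem_iff] at this
  refine mem_iUnion.mpr ⟨he, ?_⟩
  rcases this with h | h
  · exact ⟨0, h.symm⟩
  · exact ⟨1, h.symm⟩

lemma exists_eq_pt_of_mem_trace {e e' : Sym2 V} (hne : e ≠ e') {z : ℂ} (hz : z ∈ D.trace e)
    (hz' : z ∈ D.trace e') : ∃ v ∈ e, v ∈ e' ∧ z = D.pt v := by
  obtain ⟨he, t, rfl⟩ := mem_iUnion.mp hz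
  obtain ⟨he', t', ht'⟩ := mem_iUnion.mp hz'
  obtain ⟨v, hv, hv'⟩ := D.exists_curve_eq_pt
    (D.curve_eq_curve (fun h => hne (congrArg Subtype.val h)) ht'.symm).1
  exact ⟨v, hv, D.mem_of_pt_mem_trace (hv' ▸ hz'), hv'⟩

lemma isCompact_trace (e : Sym2 V) : IsCompact (D.trace e) := by
  by_cases he : e ∈ G.edgeSet
  · rw [D.trace_eq ⟨e, he⟩]
    exact isCompact_range (D.continuous_curve _)
  · rw [D.trace_eq_empty he]
    exact isCompact_empty

lemma hasLog_trace {e : Sym2 V} (he : e ∈ G.edgeSet) : HasLog (D.trace e) := by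
  rw [D.trace_eq ⟨e, he⟩]
  exact hasLog_range_arc (D.continuous_curve _) (D.curve_injective _)

lemma joinedIn_trace {u v : V} (h : G.Adj u v) : JoinedIn (D.trace s(u, v)) (D.pt u) (D.pt v) := by
  have hpc : IsPathConnected (D.trace s(u, v)) := by
    rw [D.trace_eq ⟨s(u, v), h⟩]
    have : PathConnectedSpace unitInterval := isPathConnected_iff_pathConnectedSpace.mp
      ((convex_Icc (0 : ℝ) 1).isPathConnected ⟨0, by simp⟩)
    exact isPathConnected_range (D.continuous_curve _)
  exact hpc.joinedIn _ (D.pt_mem_trace h (by simp)) _ (D.pt_mem_trace h (by simp))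

lemma trace_subset_carrier {S : Set (Sym2 V)} {e : Sym2 V} (he : e ∈ S) :
    D.trace e ⊆ D.carrier S :=
  subset_union_of_subset_right (subset_biUnion_of_mem (u := D.trace) he) _

lemma pt_mem_carrier (S : Set (Sym2 V)) (v : V) : D.pt v ∈ D.carrier S := .inl ⟨v, rfl⟩

lemma carrier_mono {S T : Set (Sym2 V)} (h : S ⊆ T) : D.carrier S ⊆ D.carrier T :=
  union_subset_union_right _ (biUnion_subset_biUnion_left h)

lemma carrier_insert (S : Set (Sym2 V)) (e : Sym2 V) :
    D.carrier (insert e S) = D.carrier S ∪ D.trace e := by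
  rw [carrier, biUnion_insert, carrier, union_assoc, union_comm (D.trace e)]

lemma carrier_inter_trace_subset {S : Set (Sym2 V)} {u v : V} (he : s(u, v) ∉ S) :
    D.carrier S ∩ D.trace s(u, v) ⊆ {D.pt u, D.pt v} := by
  rintro z ⟨⟨w, rfl⟩ | hz, hz'⟩
  · have := D.mem_of_pt_mem_trace hz'
    simp only [Sym2.mem_iff] at this
    rcases this with rfl | rfl <;> simp
  · obtain ⟨e', he', hz⟩ := mem_iUnion₂.mp hz
    obtain ⟨w, -, hw, rfl⟩ := D.exists_eq_pt_of_mem_trace (ne_of_mem_of_not_mem he' he) hz hz'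
    simp only [Sym2.mem_iff] at hw
    rcases hw with rfl | rfl <;> simp

lemma joinedIn_carrier_of_reachable {H : SimpleGraph V} (hH : H ≤ G) {u v : V}
    (h : H.Reachable u v) : JoinedIn (D.carrier H.edgeSet) (D.pt u) (D.pt v) := by
  obtain ⟨w⟩ := h
  induction w with
  | nil => exact JoinedIn.refl (D.pt_mem_carrier _ _)
  | cons hadj _ ih =>
    exact ((D.joinedIn_trace (hH hadj)).mono (D.trace_subset_carrier hadj)).trans ih

variable [Finite V]

lemma isCompact_carrier (S : Set (Sym2 V)) : IsCompact (D.carrier S) :=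
  (finite_range _).isCompact.union (S.toFinite.isCompact_biUnion fun e _ => D.isCompact_trace e)

/-- Induction on the edges. Every edge is a bridge, so deleting one leaves two disjoint closed
pieces, each touching the deleted arc only at one of its ends; gluing across one-point intersections
restores the whole. -/
lemma hasLog_carrier_of_isAcyclic {H : SimpleGraph V} (hHG : H ≤ G) (hH : H.IsAcyclic) :
    HasLog (D.carrier H.edgeSet) := by
  induction hn : H.edgeSet.ncard generalizing H with
  | zero =>
    rw [ncard_eq_zero] at hn
    rw [hn, carrier]
    simpa using hasLog_of_finite (finite_range D.pt)
  | succ n ih =>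
    obtain ⟨e, he⟩ : H.edgeSet.Nonempty := by
      rw [nonempty_iff_ne_empty]; rintro h; simp [h] at hn
    induction e using Sym2.ind with | _ u v
    have hadj : H.Adj u v := he
    have hr : ¬ (H.deleteEdges {s(u, v)}).Reachable u v :=
      isBridge_iff.mp (isAcyclic_iff_forall_adj_isBridge.mp hH hadj)
    set H' := H.deleteEdges {s(u, v)} with hH'
    have hset : H.edgeSet = insert s(u, v) H'.edgeSet := by
      rw [hH', edgeSet_deleteEdges, insert_sdiff_singleton, insert_eq_of_mem he]
    have hnot : s(u, v) ∉ H'.edgeSet := by simp [hH']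
    have hle : H' ≤ H := deleteEdges_le _
    have hl : HasLog (D.carrier H'.edgeSet) := by
      refine ih (hle.trans hHG) (hH.anti hle) ?_
      rw [hset, ncard_insert_of_notMem hnot (toFinite _)] at hn
      omega
    let piece (A : Set V) : Set ℂ :=
      D.pt '' A ∪ ⋃ e ∈ {e | e ∈ H'.edgeSet ∧ ∀ w ∈ e, w ∈ A}, D.trace e
    have hclosed : ∀ A, IsClosed (piece A) := fun A =>
      ((toFinite _).isCompact.union
        ((toFinite _).isCompact_biUnion fun e _ => D.isCompact_trace e)).isClosed
    set A : Set V := {w | H'.Reachable u w}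
    have hmeet : ∀ B : Set V, ∀ z ∈ piece B, z ∈ D.trace s(u, v) →
        ∃ w ∈ B, (w = u ∨ w = v) ∧ z = D.pt w := by
      rintro B z (⟨w, hw, rfl⟩ | hz) hz'
      · exact ⟨w, hw, by simpa using D.mem_of_pt_mem_trace hz', rfl⟩
      · obtain ⟨e, ⟨he, heB⟩, hz⟩ := mem_iUnion₂.mp hz
        obtain ⟨w, hw, hw', rfl⟩ := D.exists_eq_pt_of_mem_trace (ne_of_mem_of_not_mem he hnot) hz hz'
        exact ⟨w, heB w hw, by simpa using hw', rfl⟩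
    have huA : u ∈ A := Reachable.refl u
    have hvA : v ∈ Aᶜ := hr
    have hunion : D.carrier H'.edgeSet = piece A ∪ piece Aᶜ := by
      ext z
      simp only [carrier, piece, mem_union, mem_range, mem_iUnion, mem_image, exists_prop]
      constructor
      · rintro (⟨w, rfl⟩ | ⟨e, he, hz⟩)
        · by_cases hw : w ∈ A
          · exact .inl (.inl ⟨w, hw, rfl⟩)
          · exact .inr (.inl ⟨w, hw, rfl⟩)
        · induction e using Sym2.ind with | _ a b
          have hab : H'.Adj a b := he
          by_cases ha : a ∈ A
          · refine .inl (.inr ⟨_, ⟨he, fun w hw => ?_⟩, hz⟩)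
            rcases Sym2.mem_iff.mp hw with rfl | rfl
            · exact ha
            · exact Reachable.trans ha hab.reachable
          · refine .inr (.inr ⟨_, ⟨he, fun w hw => ?_⟩, hz⟩)
            rcases Sym2.mem_iff.mp hw with rfl | rfl
            · exact ha
            · exact fun hb => ha (Reachable.trans hb hab.symm.reachable)
      · rintro ((⟨w, -, rfl⟩ | ⟨e, ⟨he, -⟩, hz⟩) | (⟨w, -, rfl⟩ | ⟨e, ⟨he, -⟩, hz⟩))
        · exact .inl ⟨w, rfl⟩
        · exact .inr ⟨e, he, hz⟩
        · exact .inl ⟨w, rfl⟩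
        · exact .inr ⟨e, he, hz⟩
    have hdisj : Disjoint (piece A) (piece Aᶜ) := by
      rw [Set.disjoint_left]
      rintro z (⟨w, hw, rfl⟩ | hz) (⟨w', hw', h⟩ | hz')
      · exact hw' (D.pt_injective h ▸ hw)
      · obtain ⟨e, ⟨he, heA⟩, hz'⟩ := mem_iUnion₂.mp hz'
        exact heA w (D.mem_of_pt_mem_trace hz') hw
      · obtain ⟨e, ⟨he, heA⟩, hz⟩ := mem_iUnion₂.mp hz
        exact hw' (heA w' (D.mem_of_pt_mem_trace (h ▸ hz)))
      · obtain ⟨e, ⟨he, heA⟩, hz⟩ := mem_iUnion₂.mp hz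
        obtain ⟨e', ⟨he', heA'⟩, hz'⟩ := mem_iUnion₂.mp hz'
        by_cases hee : e = e'
        · subst hee
          induction e using Sym2.ind with | _ a b
          exact heA' a (by simp) (heA a (by simp))
        · obtain ⟨w, hw, hw', -⟩ := D.exists_eq_pt_of_mem_trace hee hz hz'
          exact heA' w hw' (heA w hw)
    rw [hset, carrier_insert, hunion, union_right_comm]
    rw [hunion] at hl
    -- Each piece inherits logarithms from the disjoint union; then the piece of `u`, the arc and
    -- the piece of `v` are glued in this order.
    have hAB := hl.of_union (hclosed _) (hclosed _) hdisj
    have hBA := (union_comm (piece A) _ ▸ hl).of_union (hclosed _) (hclosed _) hdisj.symm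
    have hte := (D.isCompact_trace s(u, v)).isClosed
    refine ((hAB.union (hclosed _) hte (D.hasLog_trace (hHG hadj)) ?_).union
      ((hclosed _).union hte) (hclosed _) hBA ?_)
    · refine subsingleton_of_forall_eq (D.pt u) fun z hz => ?_
      obtain ⟨w, hw, rfl | rfl, rfl⟩ := hmeet A z hz.1 hz.2
      · rfl
      · exact (hvA hw).elim
    · refine subsingleton_of_forall_eq (D.pt v) fun z hz => ?_
      rcases hz with ⟨hz | hz, hz'⟩
      · exact (hdisj.le_bot ⟨hz, hz'⟩).elim
      · obtain ⟨w, hw, rfl | rfl, rfl⟩ := hmeet Aᶜ z hz' hz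
        · exact (hw huA).elim
        · rfl

end SimpleGraph.PlaneDrawing

end

/-! ### Faces of a drawing. -/

section

open Complex Set Topology

/-- On the circle about `p` of radius `‖p - q‖ / 2` the factor `z - q` has a logarithm while `z - p`
winds once, so `L` would change by `-2πi` around a closed curve. -/
lemma not_exists_log_div {p q : ℂ} (hpq : p ≠ q) {L : ℂ → ℂ} (hL : ContinuousOn L {p, q}ᶜ)
    (h : ∀ z ∈ ({p, q} : Set ℂ)ᶜ, exp (L z) = (z - q) / (z - p)) : False := by
  have hpq' : p - q ≠ 0 := sub_ne_zero.mpr hpq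
  set r : ℝ := ‖p - q‖ / 2
  have hr : 0 < r := by have := norm_pos_iff.mpr hpq'; positivity
  have hr0 : (r : ℂ) ≠ 0 := by exact_mod_cast hr.ne'
  set z : ℝ → ℂ := fun θ => p + r * exp (θ * I) with hz
  have hzc : Continuous z := by fun_prop
  have hzp : ∀ θ, z θ - p = r * exp (θ * I) := fun θ => by simp [hz]
  have hnorm : ∀ θ, ‖z θ - p‖ = r := fun θ => by
    rw [hzp, norm_mul, norm_exp_ofReal_mul_I, mul_one, Complex.norm_real, Real.norm_of_nonneg hr.le]
  have hslit : ∀ θ, (z θ - q) / (p - q) ∈ slitPlane := by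
    intro θ
    have h1 : (z θ - q) / (p - q) = 1 + (z θ - p) / (p - q) := by field_simp; ring
    rw [h1]
    refine mem_slitPlane_of_norm_lt_one ?_
    rw [norm_div, hnorm, div_lt_one (norm_pos_iff.mpr hpq')]
    exact half_lt_self (norm_pos_iff.mpr hpq')
  have hzq : ∀ θ, z θ - q ≠ 0 := fun θ h0 => by
    have := slitPlane_ne_zero (hslit θ)
    simp [h0] at this
  have hzp0 : ∀ θ, z θ - p ≠ 0 := fun θ => by
    rw [hzp]; exact mul_ne_zero hr0 (exp_ne_zero _)
  have hmem : ∀ θ, z θ ∈ ({p, q} : Set ℂ)ᶜ := by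
    rintro θ (h' | h')
    · exact hzp0 θ (sub_eq_zero.mpr h')
    · exact hzq θ (sub_eq_zero.mpr h')
  have key : ∀ θ : ℝ, exp (L (z θ) - log ((z θ - q) / (p - q)) + θ * I) = (p - q) / r := by
    intro θ
    rw [exp_add, exp_sub, h _ (hmem θ), exp_log (slitPlane_ne_zero (hslit θ)), hzp]
    have := hzq θ
    have := exp_ne_zero (θ * I)
    field_simp
  have hcont : Continuous fun θ : ℝ => L (z θ) - log ((z θ - q) / (p - q)) + θ * I := by
    refine ((hL.comp_continuous hzc hmem).sub (Continuous.clog ?_ hslit)).add (by fun_prop)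
    fun_prop
  have := isPreconnected_univ.eq_of_exp_eq (X := ℝ) hcont.continuousOn
    (fun θ _ => key θ) (mem_univ 0) (mem_univ (2 * Real.pi))
  have h0 : z (2 * Real.pi) = z 0 := by simp [hz, exp_two_pi_mul_I]
  rw [h0] at this
  have h3 : 2 * Real.pi * I = 0 := by
    push_cast at this
    linear_combination -this
  simp [Real.pi_ne_zero] at h3

/-- On the closure of a bounded face containing `a i` the other factors do not vanish, so
`eq_zero_of_zpow_extends` kills the exponent `m i`. At most one of the points lies in the unbounded
face, and its exponent vanishes because the sum does. -/
lemma eq_zero_of_log_prod_zpow {ι : Type*} [Fintype ι] {K : Set ℂ} (hK : IsCompact K)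
    {a : ι → ℂ} (haK : ∀ i, a i ∉ K) (hna : ∀ i j, i ≠ j → ¬ JoinedIn Kᶜ (a i) (a j))
    {m : ι → ℤ} (hm : ∑ i, m i = 0) {g : ℂ → ℂ} (hg : ContinuousOn g K)
    (hg' : ∀ z ∈ K, exp (g z) = ∏ i, (z - a i) ^ m i) : m = 0 := by
  classical
  have key : ∀ i, Bornology.IsBounded (pathComponentIn Kᶜ (a i)) → m i = 0 := by
    intro i hi
    have ho := hK.isClosed.isOpen_compl.pathComponentIn (a i)
    have hne : ∀ z ∈ closure (pathComponentIn Kᶜ (a i)), ∀ j, j ≠ i → z - a j ≠ 0 := by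
      intro z hz j hj h0
      rw [closure_eq_self_union_frontier] at hz
      rw [sub_eq_zero] at h0
      rcases hz with hz | hz
      · exact hna i j hj.symm (h0 ▸ hz)
      · exact haK j (h0 ▸ frontier_pathComponentIn_subset hK.isClosed _ hz)
    refine eq_zero_of_zpow_extends hK.isClosed hi
      (frontier_pathComponentIn_subset hK.isClosed _) (a := a i) (g := g)
      (R := fun z => ∏ j ∈ Finset.univ.erase i, (z - a j) ^ (- m j)) ?_ hg ?_ ?_ ?_
    · rw [ho.interior_eq]
      exact mem_pathComponentIn_self (haK i)
    · refine continuousOn_finsetProd _ fun j hj => ContinuousOn.zpow₀ (by fun_prop) _ fun z hz =>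
        .inl (hne z hz j (Finset.ne_of_mem_erase hj))
    · exact fun z hz => Finset.prod_ne_zero_iff.mpr fun j hj =>
        zpow_ne_zero _ (hne z hz j (Finset.ne_of_mem_erase hj))
    · intro z hz
      rw [hg' z hz, ← Finset.mul_prod_erase _ _ (Finset.mem_univ i), mul_assoc,
        ← Finset.prod_mul_distrib, Finset.prod_eq_one, mul_one]
      intro j _
      rw [← zpow_add₀, add_neg_cancel, zpow_zero]
      rw [sub_ne_zero]
      rintro rfl
      exact haK j hz
  funext i
  by_cases hi : m i = 0
  · exact hi
  · rw [Finset.sum_eq_single i (fun j _ hj => ?_) (by simp)] at hm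
    · exact hm
    · refine key j ((isBounded_pathComponentIn_or hK (hna i j hj.symm)).resolve_left ?_)
      exact fun h => hi (key i h)

namespace SimpleGraph.PlaneDrawing

variable {V : Type*} {G : SimpleGraph V} (D : G.PlaneDrawing)

/-- The trace of an edge without the vertices. -/
def inner (e : Sym2 V) : Set ℂ := D.trace e \ range D.pt

lemma isPathConnected_inner {e : Sym2 V} (he : e ∈ G.edgeSet) : IsPathConnected (D.inner e) := by
  have hc : Continuous fun t : ℝ => D.curve ⟨e, he⟩ (projIcc 0 1 zero_le_one t) :=
    (D.continuous_curve _).comp continuous_projIcc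
  have := ((convex_Ioo (0 : ℝ) 1).isPathConnected ⟨1 / 2, by norm_num⟩).image hc
  convert this using 1
  ext z
  constructor
  · rintro ⟨hz, hz'⟩
    obtain ⟨_, t, rfl⟩ := mem_iUnion.mp hz
    have hne : ¬ (t = 0 ∨ t = 1) := fun h => by
      obtain ⟨v, -, hv⟩ := D.exists_curve_eq_pt (e := ⟨e, he⟩) h
      exact hz' ⟨v, hv.symm⟩
    push Not at hne
    refine ⟨t, ⟨unitInterval.pos_iff_ne_zero.mpr hne.1, unitInterval.lt_one_iff_ne_one.mpr hne.2⟩, ?_⟩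
    beta_reduce
    rw [projIcc_val]
  · rintro ⟨t, ht, rfl⟩
    have htI : t ∈ Icc (0 : ℝ) 1 := Ioo_subset_Icc_self ht
    beta_reduce
    rw [projIcc_of_mem _ htI]
    refine ⟨mem_iUnion.mpr ⟨he, _, rfl⟩, ?_⟩
    rintro ⟨v, hv⟩
    rcases D.curve_eq_pt hv.symm with h | h
    · exact ht.1.ne' (congrArg Subtype.val h)
    · exact ht.2.ne (congrArg Subtype.val h)

lemma inner_subset_compl_carrier {S : Set (Sym2 V)} {e : Sym2 V} (he : e ∉ S) :
    D.inner e ⊆ (D.carrier S)ᶜ := by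
  rintro z ⟨hz, hz'⟩ (h | h)
  · exact hz' h
  · obtain ⟨e', he', h⟩ := mem_iUnion₂.mp h
    obtain ⟨v, -, -, rfl⟩ := D.exists_eq_pt_of_mem_trace (ne_of_mem_of_not_mem he' he) h hz
    exact hz' ⟨v, rfl⟩

lemma inner_subset_pathComponentIn {S : Set (Sym2 V)} {e : Sym2 V} (he : e ∉ S)
    (heG : e ∈ G.edgeSet) {x : ℂ} (hx : x ∈ D.inner e) :
    D.inner e ⊆ pathComponentIn (D.carrier S)ᶜ x :=
  (D.isPathConnected_inner heG).subset_pathComponentIn hx (D.inner_subset_compl_carrier he)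

variable [Finite V]

/-- Adding an edge between two already connected vertices disconnects a face. -/
lemma exists_not_joinedIn_insert {S : Set (Sym2 V)} {u v : V} (huv : G.Adj u v)
    (he : s(u, v) ∉ S) (hS : JoinedIn (D.carrier S) (D.pt u) (D.pt v)) {x : ℂ}
    (hx : x ∈ D.inner s(u, v)) :
    ∃ a b, JoinedIn (D.carrier S)ᶜ x a ∧ JoinedIn (D.carrier S)ᶜ x b ∧
      a ∉ D.carrier (insert s(u, v) S) ∧ b ∉ D.carrier (insert s(u, v) S) ∧
      ¬ JoinedIn (D.carrier (insert s(u, v) S))ᶜ a b := by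
  classical
  -- Write `p`, `q` for the ends. `(z - q) / (z - p)` has a logarithm `M` off the old drawing and a
  -- logarithm `L` off the new arc. If the arc did not split its face `U`, then `L - M` would be
  -- constant on `U` minus the arc, so a shift of `M` on `U` and `L` off the arc would glue to a
  -- logarithm on the plane minus `p` and `q`.
  by_contra! hcon
  obtain ⟨M, hM, hM'⟩ := hS.exists_log_div
  obtain ⟨L, hL, hL'⟩ := (D.joinedIn_trace huv).exists_log_div
  set U := pathComponentIn (D.carrier S)ᶜ x
  have hU : IsOpen U := (D.isCompact_carrier S).isClosed.isOpen_compl.pathComponentIn x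
  have hUS : U ⊆ (D.carrier S)ᶜ := pathComponentIn_subset
  have hsub1 : (D.carrier (insert s(u, v) S))ᶜ ⊆ (D.trace s(u, v))ᶜ :=
    compl_subset_compl.mpr (D.trace_subset_carrier (mem_insert _ _))
  have hsub2 : (D.carrier (insert s(u, v) S))ᶜ ⊆ (D.carrier S)ᶜ :=
    compl_subset_compl.mpr (D.carrier_mono (subset_insert _ _))
  have hexp : ∀ z ∈ (D.carrier (insert s(u, v) S))ᶜ, exp (L z - M z) = 1 := by
    intro z hz
    rw [exp_sub, hL' z (hsub1 hz), ← hM' z (hsub2 hz), div_self (exp_ne_zero _)]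
  have hmem : ∀ z ∈ U, z ∉ D.trace s(u, v) → z ∈ (D.carrier (insert s(u, v) S))ᶜ := by
    intro z hz hz'
    rw [carrier_insert]
    rintro (h | h)
    · exact hUS hz h
    · exact hz' h
  obtain ⟨c, hc, hc'⟩ : ∃ c, exp c = 1 ∧ ∀ z ∈ U, z ∉ D.trace s(u, v) → L z = M z + c := by
    by_cases hne : ∃ a ∈ U, a ∉ D.trace s(u, v)
    · obtain ⟨a, haU, ha⟩ := hne
      refine ⟨L a - M a, hexp a (hmem a haU ha), fun z hzU hz => ?_⟩
      have : L z - M z = L a - M a :=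
        (hcon z a hzU haU (hmem z hzU hz) (hmem a haU ha)).eq_of_exp_eq ((hL.mono hsub1).sub (hM.mono hsub2)) hexp
      linear_combination this
    · push Not at hne
      exact ⟨0, exp_zero, fun z hzU hz => (hz (hne z hzU)).elim⟩
  have hcover : ∀ z ∈ ({D.pt u, D.pt v} : Set ℂ)ᶜ, z ∈ U ∪ (D.trace s(u, v))ᶜ := by
    intro z hz
    by_cases hzt : z ∈ D.trace s(u, v)
    · refine .inl (D.inner_subset_pathComponentIn he huv hx ⟨hzt, ?_⟩)
      rintro ⟨w, rfl⟩
      have := D.mem_of_pt_mem_trace hzt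
      rw [Sym2.mem_iff] at this
      rcases this with rfl | rfl <;> simp at hz
    · exact .inr hzt
  have h1 : EqOn (U.piecewise (fun z => M z + c) L) (fun z => M z + c) U := fun z hz => by simp [hz]
  have h2 : EqOn (U.piecewise (fun z => M z + c) L) L (D.trace s(u, v))ᶜ := fun z hz => by
    by_cases hzU : z ∈ U
    · simp [hzU, hc' z hzU hz]
    · simp [hzU]
  refine not_exists_log_div (D.pt_injective.ne huv.ne)
    ((((hM.mono hUS).add_const c).congr h1).union_of_isOpen (hL.congr h2) hU
      (D.isCompact_trace _).isClosed.isOpen_compl |>.mono hcover) fun z hz => ?_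
  rcases hcover z hz with hz | hz
  · rw [h1 hz, exp_add, hc, mul_one, hM' z (hUS hz)]
  · rw [h2 hz, hL' z hz]

/-- The drawing of a graph has at least as many faces as predicted by Euler's formula. -/
lemma exists_finset_not_joinedIn {T : SimpleGraph V} (hT : T ≤ G) (R : Finset (Sym2 V))
    (hRG : ∀ e ∈ R, e ∈ G.edgeSet) (hRT : ∀ e ∈ R, e ∉ T.edgeSet)
    (hR : ∀ u v, s(u, v) ∈ R → T.Reachable u v) :
    ∃ A : Finset ℂ, A.card = R.card + 1 ∧ (∀ a ∈ A, a ∉ D.carrier (T.edgeSet ∪ R)) ∧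
      ∀ a ∈ A, ∀ b ∈ A, a ≠ b → ¬ JoinedIn (D.carrier (T.edgeSet ∪ R))ᶜ a b := by
  classical
  induction R using Finset.induction_on with
  | empty =>
    obtain ⟨a, ha⟩ := (ne_univ_iff_exists_notMem _).mp (D.isCompact_carrier
      (T.edgeSet ∪ (∅ : Finset (Sym2 V)))).ne_univ
    exact ⟨{a}, by simp, by simpa using ha, by simp +contextual⟩
  | insert e R heR ih =>
    obtain ⟨A, hA, hAc, hAj⟩ := ih (fun e he => hRG e (Finset.mem_insert_of_mem he))
      (fun e he => hRT e (Finset.mem_insert_of_mem he))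
      (fun u v he => hR u v (Finset.mem_insert_of_mem he))
    have heG := hRG e (Finset.mem_insert_self _ _)
    set S : Set (Sym2 V) := T.edgeSet ∪ R with hS
    have heS : e ∉ S := by
      simp only [hS, mem_union, not_or]
      exact ⟨hRT e (Finset.mem_insert_self _ _), heR⟩
    have hSe : T.edgeSet ∪ ((insert e R : Finset (Sym2 V)) : Set (Sym2 V)) = insert e S := by
      rw [Finset.coe_insert, union_insert]
    rw [hSe]
    obtain ⟨x, hx⟩ := (D.isPathConnected_inner heG).nonempty
    obtain ⟨a, b, ha, hb, ha', hb', hab⟩ : ∃ a b, JoinedIn (D.carrier S)ᶜ x a ∧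
        JoinedIn (D.carrier S)ᶜ x b ∧ a ∉ D.carrier (insert e S) ∧
        b ∉ D.carrier (insert e S) ∧ ¬ JoinedIn (D.carrier (insert e S))ᶜ a b := by
      induction e using Sym2.ind with | _ u v
      exact D.exists_not_joinedIn_insert heG heS ((D.joinedIn_carrier_of_reachable hT
        (hR u v (Finset.mem_insert_self _ _))).mono (D.carrier_mono subset_union_left)) hx
    have hsub : (D.carrier (insert e S))ᶜ ⊆ (D.carrier S)ᶜ :=
      compl_subset_compl.mpr (D.carrier_mono (subset_insert _ _))
    -- The representatives outside the face being split; at most one element of `A` is lost, and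
    -- `a`, `b` are gained.
    set B := A.filter fun c => ¬ JoinedIn (D.carrier S)ᶜ x c with hB
    have hBn : ∀ c ∈ B, ∀ d, JoinedIn (D.carrier S)ᶜ x d →
        ¬ JoinedIn (D.carrier (insert e S))ᶜ d c := fun c hc d hd h =>
      (Finset.mem_filter.mp hc).2 (hd.trans (h.mono hsub))
    have hBc : ∀ c ∈ B, c ∉ D.carrier (insert e S) := by
      intro c hc
      rw [carrier_insert]
      rintro (h | h)
      · exact hAc c (Finset.mem_filter.mp hc).1 h
      · refine (Finset.mem_filter.mp hc).2 (D.inner_subset_pathComponentIn heS heG hx ⟨h, ?_⟩)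
        rintro ⟨v, rfl⟩
        exact hAc _ (Finset.mem_filter.mp hc).1 (D.pt_mem_carrier _ _)
    have hBcard : A.card ≤ B.card + 1 := by
      have h1 : (A.filter fun c => JoinedIn (D.carrier S)ᶜ x c).card ≤ 1 := by
        refine Finset.card_le_one.mpr fun c hc d hd => ?_
        rw [Finset.mem_filter] at hc hd
        by_contra hcd
        exact hAj c hc.1 d hd.1 hcd (hc.2.symm.trans hd.2)
      have h2 : (A.filter fun c => JoinedIn (D.carrier S)ᶜ x c).card + B.card = A.card := by
        rw [hB]
        convert Finset.card_filter_add_card_filter_not (s := A) fun c => JoinedIn (D.carrier S)ᶜ x c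
      omega
    have hbB : b ∉ B := fun h => hBn b h b hb (JoinedIn.refl hb')
    have haB : a ∉ insert b B := by
      rw [Finset.mem_insert]
      rintro (rfl | h)
      · exact hab (JoinedIn.refl ha')
      · exact hBn a h a ha (JoinedIn.refl ha')
    -- A subset is taken since there is one point too many when `A` had no representative in the
    -- split face.
    obtain ⟨C, hCsub, hC⟩ := Finset.exists_subset_card_eq
      (s := insert a (insert b B)) (n := (insert e R).card + 1) (by
        rw [Finset.card_insert_of_notMem haB, Finset.card_insert_of_notMem hbB,
          Finset.card_insert_of_notMem heR]
        omega)
    have hall : ∀ c ∈ C, c = a ∨ c = b ∨ c ∈ B := fun c hc => by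
      simpa using hCsub hc
    refine ⟨C, hC, fun c hc => ?_, fun c hc d hd hcd h => ?_⟩
    · rcases hall c hc with rfl | rfl | h
      exacts [ha', hb', hBc _ h]
    · rcases hall c hc with rfl | rfl | hc' <;> rcases hall d hd with rfl | rfl | hd'
      · exact hcd rfl
      · exact hab h
      · exact hBn _ hd' _ ha h
      · exact hab h.symm
      · exact hcd rfl
      · exact hBn _ hd' _ hb h
      · exact hBn _ hc' _ ha h.symm
      · exact hBn _ hc' _ hb h.symm
      · exact hAj _ (Finset.mem_filter.mp hc').1 _ (Finset.mem_filter.mp hd').1 hcd (h.mono hsub)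

/-- At most two faces lie along an edge. -/
lemma not_three_faces_along_edge {S : Set (Sym2 V)} {e : Sym2 V} (heG : e ∈ G.edgeSet)
    (he : e ∉ S) {x : ℂ} {a : Fin 3 → ℂ} (hxa : ∀ i, JoinedIn (D.carrier S)ᶜ x (a i))
    (ha : ∀ i, a i ∉ D.carrier (insert e S))
    (hna : ∀ i j, i ≠ j → ¬ JoinedIn (D.carrier (insert e S))ᶜ (a i) (a j)) : False := by
  -- The two quotients `(z - a i.succ) / (z - a 0)` have logarithms on the old drawing and on the
  -- arc. These meet only in two points, so a nontrivial monomial in the quotients has a logarithm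
  -- on the union; its exponents at the three points sum to zero, which is impossible for points in
  -- distinct faces.
  have hj : ∀ i : Fin 2, JoinedIn (D.carrier S)ᶜ (a 0) (a i.succ) := fun i =>
    (hxa 0).symm.trans (hxa _)
  choose g hg hg' using fun i => (hj i).exists_log_div
  rw [compl_compl] at hg hg'
  have hsub : D.trace e ⊆ D.carrier (insert e S) := D.trace_subset_carrier (mem_insert _ _)
  have hne : ∀ z ∈ D.carrier (insert e S), ∀ i, z - a i ≠ 0 := fun z hz i h0 =>
    ha i (sub_eq_zero.mp h0 ▸ hz)
  choose h hh hh' using fun i : Fin 2 => D.hasLog_trace heG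
    (fun z => (z - a i.succ) / (z - a 0))
    (ContinuousOn.div (by fun_prop) (by fun_prop) fun z hz => hne z (hsub hz) 0)
    (fun z hz => div_ne_zero (hne z (hsub hz) _) (hne z (hsub hz) _))
  obtain ⟨k, hk0, L, hL, hL'⟩ : ∃ k : Fin 2 → ℤ, k ≠ 0 ∧ ∃ L : ℂ → ℂ,
      ContinuousOn L (D.carrier S ∪ D.trace e) ∧ ∀ z ∈ D.carrier S ∪ D.trace e, exp (L z) =
        ((z - a 1) / (z - a 0)) ^ k 0 * ((z - a 2) / (z - a 0)) ^ k 1 := by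
    induction e using Sym2.ind with | _ u v
    exact exists_log_zpow_mul_zpow (f := fun i z => (z - a i.succ) / (z - a 0))
      (D.isCompact_carrier S).isClosed (D.isCompact_trace _).isClosed
      (D.pt_mem_carrier _ u) (D.pt_mem_trace heG (by simp)) (D.pt_mem_carrier _ v)
      (D.pt_mem_trace heG (by simp)) (D.carrier_inter_trace_subset he) hg hh hg' hh'
  rw [← carrier_insert] at hL hL'
  have := eq_zero_of_log_prod_zpow (D.isCompact_carrier (insert e S)) ha hna
    (m := ![- k 0 - k 1, k 0, k 1]) (by simp [Fin.sum_univ_three]; ring) hL (fun z hz => by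
      have h0 := hne z hz 0
      have h1 := hne z hz 1
      have h2 := hne z hz 2
      rw [hL' z hz]
      simp only [Fin.prod_univ_three, Matrix.cons_val, div_zpow]
      rw [sub_eq_add_neg (- k 0), zpow_add₀ h0, zpow_neg, zpow_neg]
      field_simp)
  refine hk0 (funext fun i => ?_)
  have hi := congrFun this i.succ
  fin_cases i <;> simpa using hi

/-- If there is more than one face, then at least four edges lie along each face, provided
that the girth is at least four. -/
lemma four_le_ncard_edges_along_face (hG : 4 ≤ G.egirth) {a b : ℂ}
    (ha : a ∉ D.carrier G.edgeSet) (hb : b ∉ D.carrier G.edgeSet)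
    (hab : ¬ JoinedIn (D.carrier G.edgeSet)ᶜ a b) :
    4 ≤ {e ∈ G.edgeSet | (D.inner e ∩
      closure (pathComponentIn (D.carrier G.edgeSet)ᶜ a)).Nonempty}.ncard := by
  classical
  by_contra! hlt
  set K := D.carrier G.edgeSet
  set W := pathComponentIn Kᶜ a
  set S := {e ∈ G.edgeSet | (D.inner e ∩ closure W).Nonempty}
  have hSG : S ⊆ G.edgeSet := fun e he => he.1
  set H := fromEdgeSet S
  have hHS : H.edgeSet = S := by
    rw [edgeSet_fromEdgeSet, sdiff_eq_left, Set.disjoint_left]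
    exact fun e he he' => G.not_isDiag_of_mem_edgeSet (hSG he) he'
  have hHG : H ≤ G := by rw [← edgeSet_subset_edgeSet, hHS]; exact hSG
  -- A cycle has at least four edges, and `S` has fewer.
  have hH : H.IsAcyclic := by
    intro v w hw
    have h1 : (4 : ℕ∞) ≤ w.length := (hG.trans (egirth_anti hHG)).trans (egirth_le_length hw)
    have h2 : w.edges.toFinset.card ≤ S.ncard := by
      rw [← ncard_coe_finset]
      refine ncard_le_ncard (fun e he => ?_) (toFinite _)
      rw [← hHS]
      exact w.edges_subset_edgeSet (by simpa using he)
    rw [List.toFinset_card_of_nodup hw.isTrail.edges_nodup, Walk.length_edges] at h2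
    have h1' : 4 ≤ w.length := by exact_mod_cast h1
    omega
  have hl := D.hasLog_carrier_of_isAcyclic hHG hH
  rw [hHS] at hl
  obtain ⟨γ, hγ⟩ := hl.joinedIn_compl (D.isCompact_carrier S)
    (fun h => ha (D.carrier_mono hSG h)) (fun h => hb (D.carrier_mono hSG h))
  have hK : IsOpen Kᶜ := (D.isCompact_carrier _).isClosed.isOpen_compl
  -- The path `γ` from `a` to `b` avoids the forest formed by `S`. It cannot leave `W`: a point of
  -- `γ` in the closure of `W` that lies on the drawing would lie inside an edge of `S`.
  refine hab ((isPreconnected_range γ.continuous).subset_of_closure_inter_subset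
    (hK.pathComponentIn a) ⟨a, ⟨0, γ.source⟩, mem_pathComponentIn_self ha⟩ ?_ ⟨1, γ.target⟩)
  rintro _ ⟨hx, t, rfl⟩
  have ht := hγ t
  set x := γ t
  by_cases hxK : x ∈ K
  · exfalso
    rcases hxK with ⟨v, hv⟩ | hxK
    · exact ht (hv ▸ D.pt_mem_carrier _ _)
    · obtain ⟨e, he, hxe⟩ := mem_iUnion₂.mp hxK
      have hxi : x ∈ D.inner e := ⟨hxe, by
        rintro ⟨v, hv⟩
        exact ht (hv ▸ D.pt_mem_carrier _ _)⟩
      exact ht (D.trace_subset_carrier (S := S) ⟨he, x, hxi, hx⟩ hxe)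
  · obtain ⟨y, hy, hy'⟩ := mem_closure_iff.mp hx _ (hK.pathComponentIn x)
      (mem_pathComponentIn_self hxK)
    exact JoinedIn.trans hy' (JoinedIn.symm hy)

end SimpleGraph.PlaneDrawing

/-! ### The edge bound for planar graphs of girth at least four. -/

namespace SimpleGraph

lemma IsAcyclic.ncard_edgeSet_lt_card {V : Type*} [Finite V] [Nonempty V] {T : SimpleGraph V}
    (hT : T.IsAcyclic) : T.edgeSet.ncard < Nat.card V := by
  classical
  have := Fintype.ofFinite V
  obtain ⟨T', hT', -, h⟩ := (connected_top (V := V)).exists_isTree_le_of_le_of_isAcyclic le_top hT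
  have h1 := ncard_le_ncard (edgeSet_mono hT') (toFinite _)
  have h2 := h.card_edgeFinset
  rw [← coe_edgeFinset T', ncard_coe_finset] at h1
  rw [Nat.card_eq_fintype_card]
  omega

/-- A planar graph of girth at least four on `n ≥ 3` vertices has at most `2 n - 4` edges. -/
theorem IsPlanar.ncard_edgeSet_add_four_le {V : Type*} [Finite V] {G : SimpleGraph V}
    (hp : G.IsPlanar) (hG : 4 ≤ G.egirth) (hV : 3 ≤ Nat.card V) :
    G.edgeSet.ncard + 4 ≤ 2 * Nat.card V := by
  classical
  obtain ⟨D⟩ := hp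
  have : Nonempty V := (Nat.card_pos_iff.mp (by omega)).1
  obtain ⟨T, hTG, hT, hreach⟩ := exists_isAcyclic_reachable_eq_le (G := G)
  have hTcard := hT.ncard_edgeSet_lt_card
  set R : Finset (Sym2 V) := (toFinite (G.edgeSet \ T.edgeSet)).toFinset with hR
  have hmemR : ∀ e, e ∈ R ↔ e ∈ G.edgeSet ∧ e ∉ T.edgeSet := by simp [hR]
  have hsub : T.edgeSet ⊆ G.edgeSet := edgeSet_mono hTG
  have hunion : T.edgeSet ∪ R = G.edgeSet := by
    rw [hR, Finite.coe_toFinset, union_sdiff_cancel hsub]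
  have hRcard : R.card + T.edgeSet.ncard = G.edgeSet.ncard := by
    rw [hR, ← ncard_eq_toFinset_card, ncard_sdiff_add_ncard_of_subset hsub]
  obtain ⟨A, hA, hAc, hAj⟩ := D.exists_finset_not_joinedIn hTG R (fun e he => ((hmemR e).mp he).1)
    (fun e he => ((hmemR e).mp he).2) (fun u v he => by
      rw [hreach]
      exact Adj.reachable ((hmemR _).mp he).1)
  rw [hunion] at hAc hAj
  set K := D.carrier G.edgeSet with hK
  -- Without extra edges `G` is a forest, and `3 ≤ Nat.card V` suffices. Otherwise there are at
  -- least two faces, as the count of edges along a face requires.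
  rcases Nat.eq_zero_or_pos R.card with h0 | h0
  · omega
  have hbound : A.card * 4 ≤ (toFinite G.edgeSet).toFinset.card * 2 := by
    refine Finset.card_mul_le_card_mul
      (fun a e => (D.inner e ∩ closure (pathComponentIn Kᶜ a)).Nonempty) (fun a ha => ?_)
      (fun e he => ?_)
    · obtain ⟨b, hb, hba⟩ := Finset.exists_mem_ne (s := A) (by omega) a
      have := D.four_le_ncard_edges_along_face hG (hAc a ha) (hAc b hb) (hAj a ha b hb hba.symm)
      rw [← ncard_coe_finset]
      convert this using 2
      ext e
      simp [Finset.bipartiteAbove, hK]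
    -- Three faces along `e` all reach into the one face of the drawing without `e` that contains
    -- the interior of `e`.
    · by_contra! hlt
      obtain ⟨a, ha, b, hb, c, hc, hab, hac, hbc⟩ := Finset.two_lt_card.mp hlt
      simp only [Finset.mem_bipartiteBelow] at ha hb hc
      have heG : e ∈ G.edgeSet := by simpa using he
      set S := G.edgeSet \ {e}
      have heS : e ∉ S := by simp [S]
      have hins : insert e S = G.edgeSet := by simp [S, insert_eq_of_mem heG]
      obtain ⟨x, hx⟩ := (D.isPathConnected_inner heG).nonempty
      have hopen := (D.isCompact_carrier S).isClosed.isOpen_compl.pathComponentIn x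
      have key : ∀ d, (D.inner e ∩ closure (pathComponentIn Kᶜ d)).Nonempty →
          ∃ d', JoinedIn (D.carrier S)ᶜ x d' ∧ JoinedIn Kᶜ d d' := by
        rintro d ⟨y, hy, hy'⟩
        exact mem_closure_iff.mp hy' _ hopen (D.inner_subset_pathComponentIn heS heG hx hy)
      obtain ⟨a', ha1, ha2⟩ := key a ha.2
      obtain ⟨b', hb1, hb2⟩ := key b hb.2
      obtain ⟨c', hc1, hc2⟩ := key c hc.2
      have hn : ∀ p q p' q', p ∈ A → q ∈ A → p ≠ q → JoinedIn Kᶜ p p' → JoinedIn Kᶜ q q' →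
          ¬ JoinedIn Kᶜ p' q' := fun p q p' q' hp hq hpq h1 h2 h3 =>
        hAj p hp q hq hpq (h1.trans (h3.trans h2.symm))
      refine D.not_three_faces_along_edge heG heS (x := x) (a := ![a', b', c']) ?_ ?_ ?_
      · intro i; fin_cases i <;> assumption
      · rw [hins]; intro i; fin_cases i
        exacts [ha2.mem.2, hb2.mem.2, hc2.mem.2]
      · rw [hins]; intro i j hij
        fin_cases i <;> fin_cases j
        exacts [(hij rfl).elim, hn a b a' b' ha.1 hb.1 hab ha2 hb2,
          hn a c a' c' ha.1 hc.1 hac ha2 hc2, hn b a b' a' hb.1 ha.1 hab.symm hb2 ha2,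
          (hij rfl).elim, hn b c b' c' hb.1 hc.1 hbc hb2 hc2,
          hn c a c' a' hc.1 ha.1 hac.symm hc2 ha2, hn c b c' b' hc.1 hb.1 hbc.symm hc2 hb2,
          (hij rfl).elim]
  rw [← ncard_eq_toFinset_card] at hbound
  -- With `f` faces found, `f = |R| + 1 ≥ |E| - |V| + 2` and `4f ≤ 2|E|`.
  omega

end SimpleGraph

end

/-! ### Planarity of two-page book embeddings. -/

namespace SimpleGraph

/-- Widening the interval strictly raises the parabola `(x - A) * (B - x)` above interior points, so
parabolas over distinct nested intervals do not cross. -/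
lemma eq_and_eq_of_mul_eq_mul_of_nested {A B A' B' x : ℝ} (hA : A ≤ A') (hB : B' ≤ B)
    (h1 : A' < x) (h2 : x < B') (h : (x - A) * (B - x) = (x - A') * (B' - x)) :
    A = A' ∧ B = B' := by
  constructor
  · by_contra hne
    have hlt := lt_of_le_of_ne hA hne
    nlinarith [mul_pos (sub_pos.mpr hlt) (sub_pos.mpr (h2.trans_le hB)),
      mul_nonneg (sub_pos.mpr h1).le (sub_nonneg.mpr hB)]
  · by_contra hne
    have hlt := lt_of_le_of_ne hB (Ne.symm hne)
    nlinarith [mul_pos (sub_pos.mpr hlt) (sub_pos.mpr h1),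
      mul_nonneg (sub_pos.mpr (h2.trans_le hB)).le (sub_nonneg.mpr hA)]

/-- A graph with a book embedding in two pages is planar: the vertices are placed on a line, and
the edges of each page are drawn as parabolas on one side of it. -/
theorem isPlanar_of_two_pages {V : Type*} {G : SimpleGraph V} {pos : V → ℝ}
    (hpos : Function.Injective pos) (P : Bool → V → V → Prop)
    (hcov : ∀ a b, G.Adj a b → pos a < pos b → ∃ i, P i a b)
    (hP : ∀ i a b c d, P i a b → P i c d → pos a < pos c → pos c < pos b → ¬ pos b < pos d) :
    G.IsPlanar := by
  have hex : ∀ e : G.edgeSet, ∃ a b i, (e : Sym2 V) = s(a, b) ∧ pos a < pos b ∧ P i a b := by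
    rintro ⟨e, he⟩
    induction e using Sym2.ind with | _ a b
    have hadj : G.Adj a b := he
    rcases lt_or_gt_of_ne (hpos.ne hadj.ne) with h | h
    · obtain ⟨i, hi⟩ := hcov a b hadj h
      exact ⟨a, b, i, rfl, h, hi⟩
    · obtain ⟨i, hi⟩ := hcov b a hadj.symm h
      exact ⟨b, a, i, Sym2.eq_swap, h, hi⟩
  choose a b i hab hlt hi using hex
  let σ : Bool → ℝ := fun i => if i then 1 else -1
  have hσ : ∀ i, σ i ≠ 0 := fun i => by cases i <;> simp [σ]
  have hx : ∀ p q x y : ℝ, (!₂[p, q] : EuclideanSpace ℝ (Fin 2)) = !₂[x, y] ↔ p = x ∧ q = y := by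
    intro p q x y
    constructor
    · intro h
      exact ⟨by simpa using congrArg (fun v => v 0) h, by simpa using congrArg (fun v => v 1) h⟩
    · rintro ⟨rfl, rfl⟩; rfl
  have hends : ∀ t : unitInterval, (t : ℝ) * (1 - t) = 0 → t = 0 ∨ t = 1 := by
    intro t h
    rcases mul_eq_zero.mp h with h | h
    · exact .inl (Subtype.ext h)
    · exact .inr (Subtype.ext (by simpa using (sub_eq_zero.mp h).symm))
  have hzero : ∀ t : unitInterval, t = 0 ∨ t = 1 → (t : ℝ) * (1 - t) = 0 := by
    rintro t (rfl | rfl) <;> simp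
  -- The graph of `σ (x - a)(b - x)` over `[a, b]`, parametrized linearly in `x`; the factor `(b -
  -- a) ^ 2` results from this substitution.
  let arc : G.edgeSet → unitInterval → EuclideanSpace ℝ (Fin 2) := fun e t =>
    !₂[pos (a e) + (pos (b e) - pos (a e)) * t,
      σ (i e) * ((pos (b e) - pos (a e)) ^ 2 * (t * (1 - t)))]
  have hsq : ∀ e, (pos (b e) - pos (a e)) ^ 2 ≠ 0 := fun e =>
    pow_ne_zero _ (sub_ne_zero.mpr (hlt e).ne')
  refine ⟨⟨fun v => !₂[pos v, 0], arc, fun v w h => hpos ((hx _ _ _ _).mp h).1, fun e => ?_,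
    fun e t t' h => ?_, fun e => ?_, fun e v t h => ?_, fun e e' hne t t' h => ?_⟩⟩
  · refine (PiLp.continuous_toLp 2 _).comp (continuous_pi fun j => ?_)
    fin_cases j <;> simp <;> fun_prop
  · have := ((hx _ _ _ _).mp h).1
    exact Subtype.ext (mul_left_cancel₀ (sub_ne_zero.mpr (hlt e).ne') (add_left_cancel this))
  · rw [hab e, Sym2.map_mk]
    simp [arc]
  · have := ((hx _ _ _ _).mp h).2
    simp only [mul_eq_zero, hσ, hsq, false_or] at this
    exact hends t (mul_eq_zero.mpr this)
  · obtain ⟨h1, h2⟩ := (hx _ _ _ _).mp h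
    have hiff : (t : ℝ) * (1 - t) = 0 ↔ (t' : ℝ) * (1 - t') = 0 := by
      constructor <;> intro h0
      · rw [h0, mul_zero, mul_zero, eq_comm, mul_eq_zero, mul_eq_zero] at h2
        exact (h2.resolve_left (hσ _)).resolve_left (hsq _)
      · rw [h0, mul_zero, mul_zero, mul_eq_zero, mul_eq_zero] at h2
        exact (h2.resolve_left (hσ _)).resolve_left (hsq _)
    by_cases h0 : (t : ℝ) * (1 - t) = 0
    · exact ⟨hends t h0, hends t' (hiff.mp h0)⟩
    exfalso
    have hpos0 : ∀ t : unitInterval, (t : ℝ) * (1 - t) ≠ 0 → 0 < (t : ℝ) ∧ 0 < 1 - (t : ℝ) := by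
      intro t ht
      exact ⟨lt_of_le_of_ne t.2.1 (left_ne_zero_of_mul ht).symm,
        lt_of_le_of_ne (sub_nonneg.mpr t.2.2) (right_ne_zero_of_mul ht).symm⟩
    obtain ⟨ht0, ht1⟩ := hpos0 t h0
    obtain ⟨ht0', ht1'⟩ := hpos0 t' (fun h => h0 (hiff.mpr h))
    have hl := sub_pos.mpr (hlt e)
    have hl' := sub_pos.mpr (hlt e')
    have hp1 : 0 < (pos (b e) - pos (a e)) ^ 2 * ((t : ℝ) * (1 - t)) := by positivity
    have hp2 : 0 < (pos (b e') - pos (a e')) ^ 2 * ((t' : ℝ) * (1 - t')) := by positivity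
    have hii : i e = i e' := by
      cases hie : i e <;> cases hie' : i e' <;> simp only [hie, hie', σ] at h2 ⊢ <;>
        simp at h2 <;> linarith
    rw [hii] at h2
    have h3 := mul_left_cancel₀ (hσ _) h2
    set x := pos (a e) + (pos (b e) - pos (a e)) * (t : ℝ) with hxdef
    have hxa : pos (a e) < x := by have := mul_pos hl ht0; linarith
    have hxb : x < pos (b e) := by have := mul_pos hl ht1; linarith
    have hxa' : pos (a e') < x := by have := mul_pos hl' ht0'; linarith
    have hxb' : x < pos (b e') := by have := mul_pos hl' ht1'; linarith
    have h4 : (x - pos (a e)) * (pos (b e) - x) = (x - pos (a e')) * (pos (b e') - x) := by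
      have e1 : (x - pos (a e)) * (pos (b e) - x) =
        (pos (b e) - pos (a e)) ^ 2 * ((t : ℝ) * (1 - t)) := by rw [hxdef]; ring
      have e2 : (x - pos (a e')) * (pos (b e') - x) =
        (pos (b e') - pos (a e')) ^ 2 * ((t' : ℝ) * (1 - t')) := by rw [h1]; ring
      rw [e1, e2, h3]
    have hie := hi e
    rw [hii] at hie
    have c1 := hP _ _ _ _ _ hie (hi e')
    have c2 := hP _ _ _ _ _ (hi e') hie
    have heq : pos (a e) = pos (a e') ∧ pos (b e) = pos (b e') := by
      rcases le_total (pos (a e)) (pos (a e')) with hA | hA <;>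
        rcases le_total (pos (b e')) (pos (b e)) with hB | hB
      · exact eq_and_eq_of_mul_eq_mul_of_nested hA hB hxa' hxb' h4
      · rcases hA.eq_or_lt with hA' | hA'
        · have := eq_and_eq_of_mul_eq_mul_of_nested hA'.ge hB hxa hxb h4.symm
          exact ⟨this.1.symm, this.2.symm⟩
        · have := c1 hA' (hxa'.trans hxb)
          exact eq_and_eq_of_mul_eq_mul_of_nested hA (not_lt.mp this) hxa' hxb' h4
      · rcases hA.eq_or_lt with hA' | hA'
        · exact eq_and_eq_of_mul_eq_mul_of_nested hA'.ge hB hxa' hxb' h4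
        · have := eq_and_eq_of_mul_eq_mul_of_nested hA
            (not_lt.mp (c2 hA' (hxa.trans hxb'))) hxa hxb h4.symm
          exact ⟨this.1.symm, this.2.symm⟩
      · have := eq_and_eq_of_mul_eq_mul_of_nested hA hB hxa hxb h4.symm
        exact ⟨this.1.symm, this.2.symm⟩
    refine hne (Subtype.ext ?_)
    rw [hab e, hab e', hpos heq.1, hpos heq.2]

end SimpleGraph

/-! ### Doubling the vertices of a forest. -/

namespace SimpleGraph

lemma IsAcyclic.exists_leaf {V : Type*} [Finite V] {F : SimpleGraph V} (hF : F.IsAcyclic)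
    (hne : F ≠ ⊥) : ∃ c u, F.Adj c u ∧ ∀ w, F.Adj c w → w = u := by
  obtain ⟨a, b, hab⟩ := ne_bot_iff_exists_adj.mp hne
  have : Nonempty V := ⟨a⟩
  have ⟨u, v, p, hp, hmax⟩ := Walk.exists_isPath_forall_isPath_length_le_length F
  have hnil : ¬ p.Nil := by
    intro h
    have := hmax _ _ (Walk.cons hab Walk.nil) (by simp [hab.ne])
    simp [Walk.length_eq_zero_iff.mpr h] at this
  refine ⟨u, p.snd, p.adj_snd hnil, fun w hadj => hF.eq_snd_of_adj_start hp hadj ?_⟩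
  have : ¬ (p.cons hadj.symm).IsPath := fun h => by simpa using hmax _ _ _ h
  by_contra hw
  exact this (hp.cons hw)

/-- A layout on a line of the pairs `(v, false)`, `(v, true)` over the vertices of a graph `F`,
in which the doubling of `F` is drawn in two pages. -/
structure DoubledLayout {V : Type*} (F : SimpleGraph V) where
  /-- the positions -/
  pos : V × Bool → ℝ
  /-- the pages -/
  page : Bool → V × Bool → V × Bool → Prop
  pos_injective : Function.Injective pos
  adj_of_page : ∀ i x y, page i x y → F.Adj x.1 y.1
  exists_page : ∀ x y, F.Adj x.1 y.1 → pos x < pos y → ∃ i, page i x y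
  noncrossing : ∀ i a b c d, page i a b → page i c d → pos a < pos c → pos c < pos b →
    ¬ pos b < pos d
  -- This and the following fields are invariants of the induction: the intervals between the copies
  -- of a vertex are laminar, and page `false` leaves room for new edges into `(u, true)` from just
  -- right of `(u, false)`.
  pair_lt : ∀ u, pos (u, false) < pos (u, true)
  laminar : ∀ u w, pos (u, false) < pos (w, false) → pos (w, false) < pos (u, true) →
    ¬ pos (u, true) < pos (w, true)
  page_right : ∀ u x y, page false x y → pos x ≤ pos (u, false) → pos (u, false) < pos y →
    ¬ pos y < pos (u, true)
  page_left : ∀ u x y, page false x y → pos (u, false) < pos x → pos x < pos (u, true) →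
    ¬ pos (u, true) < pos y

/-- Remove a leaf `c` attached to `u`, lay out the rest, and put both copies of `c` immediately
right of `(u, false)`. Their edges to `(u, false)` go on page `true`, those to `(u, true)` on page
`false`. -/
lemma IsAcyclic.nonempty_doubledLayout {V : Type*} [Finite V] {F : SimpleGraph V}
    (hF : F.IsAcyclic) : Nonempty F.DoubledLayout := by
  classical
  induction hn : F.edgeSet.ncard generalizing F with
  | zero =>
    rw [Set.ncard_eq_zero, edgeSet_eq_empty] at hn
    subst hn
    obtain ⟨N, ⟨e⟩⟩ := Finite.exists_equiv_fin V
    let f : V × Bool → ℤ := fun x => 2 * (e x.1 : ℕ) + (if x.2 then 1 else 0)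
    have hf : Function.Injective f := by
      rintro ⟨x, i⟩ ⟨y, j⟩ h
      have h' : (2 * (e x : ℕ) + (if i then 1 else 0) : ℤ) =
        2 * (e y : ℕ) + (if j then 1 else 0) := h
      have h1 : (e x : ℕ) = e y := by
        cases i <;> cases j <;> simp at h' <;> omega
      have h2 : i = j := by
        cases i <;> cases j <;> simp at h' <;> first | rfl | omega
      rw [h2, e.injective (Fin.ext h1)]
    refine ⟨⟨fun x => (f x : ℝ), fun _ _ _ => False, Int.cast_injective.comp hf, by simp, by simp,
      by simp, fun u => ?_, fun u w h1 h2 => ?_, by simp, by simp⟩⟩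
    · simp [f]
    · simp only [f, Int.cast_lt] at h1 h2 ⊢
      simp at h1 h2
      omega
  | succ n ih =>
    obtain ⟨c, u, hcu, hleaf⟩ := hF.exists_leaf fun h => by simp [h] at hn
    set F' := F.deleteEdges {s(c, u)} with hF'
    have hle : F' ≤ F := deleteEdges_le _
    have hcu' : s(c, u) ∈ F.edgeSet := hcu
    obtain ⟨L⟩ := ih (F := F') (hF.anti hle) (by
      rw [hF', edgeSet_deleteEdges, Set.ncard_sdiff_singleton_of_mem hcu', hn, Nat.add_sub_cancel])
    have hne : u ≠ c := hcu.ne'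
    have hiso : ∀ w, ¬ F'.Adj c w := by
      intro w h
      rw [hF', deleteEdges_adj] at h
      exact h.2 (by rw [hleaf w h.1]; rfl)
    have hp1 : ∀ {i x y}, L.page i x y → x.1 ≠ c := fun h hx =>
      hiso _ (hx ▸ L.adj_of_page _ _ _ h)
    have hp2 : ∀ {i x y}, L.page i x y → y.1 ≠ c := fun h hx =>
      hiso _ (hx ▸ (L.adj_of_page _ _ _ h).symm)
    -- No position lies within `3 * ε` to the right of `(u, false)`, so `l + ε` and `l + 2 * ε` are
    -- free for the copies of `c`.
    obtain ⟨ε, hε, hgap0⟩ : ∃ ε > 0, ∀ x, L.pos x ≤ L.pos (u, false) ∨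
        L.pos (u, false) + 3 * ε ≤ L.pos x := by
      have hex : ∃ δ > 0, ∀ x, L.pos (u, false) < L.pos x → L.pos (u, false) + δ ≤ L.pos x := by
        obtain ⟨x0, hx0, hmin⟩ := Set.exists_min_image {x | L.pos (u, false) < L.pos x} L.pos
          (Set.toFinite _) ⟨(u, true), L.pair_lt u⟩
        exact ⟨L.pos x0 - L.pos (u, false), sub_pos.mpr hx0, fun x hx => by
          rw [add_sub_cancel]; exact hmin x hx⟩
      obtain ⟨δ, hδ, h⟩ := hex
      refine ⟨δ / 3, by positivity, fun x => (le_or_gt (L.pos x) (L.pos (u, false))).imp_right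
        fun hx => ?_⟩
      rw [mul_div_cancel₀ _ (by norm_num)]
      exact h x hx
    set l := L.pos (u, false) with hl
    let q : V × Bool → ℝ := fun x =>
      if x.1 = c then (if x.2 then l + 2 * ε else l + ε) else L.pos x
    have hq : ∀ x : V × Bool, x.1 ≠ c → q x = L.pos x := fun x hx => by simp [q, hx]
    have hq0 : q (c, false) = l + ε := by simp [q]
    have hq1 : q (c, true) = l + 2 * ε := by simp [q]
    have hqc : ∀ x : V × Bool, x.1 = c → q x = l + ε ∨ q x = l + 2 * ε := by
      rintro ⟨x, _ | _⟩ rfl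
      exacts [.inl hq0, .inr hq1]
    have hqu : q (u, false) = l := hq _ hne
    have hgap : ∀ x : V × Bool, x.1 ≠ c → q x ≤ l ∨ l + 3 * ε ≤ q x := fun x hx => by
      rw [hq x hx]; exact hgap0 x
    have hr : l + 3 * ε ≤ q (u, true) := by
      refine (hgap (u, true) hne).resolve_left (not_le.mpr ?_)
      rw [hq _ hne]
      exact L.pair_lt u
    have hqinj : Function.Injective q := by
      rintro ⟨x, i⟩ ⟨y, j⟩ h
      by_cases hx : x = c <;> by_cases hy : y = c
      · subst hx; subst hy
        cases i <;> cases j <;> simp only [hq0, hq1] at h <;> first | rfl | linarith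
      · rcases hqc (x, i) hx with h1 | h1 <;> rcases hgap (y, j) hy with h2 | h2 <;> linarith
      · rcases hqc (y, j) hy with h1 | h1 <;> rcases hgap (x, i) hx with h2 | h2 <;> linarith
      · rw [hq _ hx, hq _ hy] at h
        exact L.pos_injective h
    have hlam : ∀ v w, v ≠ c → w ≠ c → q (v, false) < q (w, false) →
        q (w, false) < q (v, true) → ¬ q (v, true) < q (w, true) := by
      intro v w hv hw
      rw [hq (v, false) hv, hq (v, true) hv, hq (w, false) hw, hq (w, true) hw]
      exact L.laminar v w
    have hpr : ∀ v x y, v ≠ c → L.page false x y → q x ≤ q (v, false) → q (v, false) < q y →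
        ¬ q y < q (v, true) := by
      intro v x y hv h
      rw [hq (v, false) hv, hq (v, true) hv, hq x (hp1 h), hq y (hp2 h)]
      exact L.page_right v x y h
    have hpl : ∀ v x y, v ≠ c → L.page false x y → q (v, false) < q x → q x < q (v, true) →
        ¬ q (v, true) < q y := by
      intro v x y hv h
      rw [hq (v, false) hv, hq (v, true) hv, hq x (hp1 h), hq y (hp2 h)]
      exact L.page_left v x y h
    have hnc : ∀ i a b d e, L.page i a b → L.page i d e → q a < q d → q d < q b → ¬ q b < q e := by
      intro i a b d e h h'
      rw [hq _ (hp1 h), hq _ (hp2 h), hq _ (hp1 h'), hq _ (hp2 h')]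
      exact L.noncrossing i a b d e h h'
    let Q : Bool → V × Bool → V × Bool → Prop := fun i x y => L.page i x y ∨
      (i = true ∧ x = (u, false) ∧ y.1 = c) ∨ (i = false ∧ x.1 = c ∧ y = (u, true))
    refine ⟨⟨q, Q, hqinj, ?_, ?_, ?_, ?_, ?_, ?_, ?_⟩⟩
    · rintro i x y (h | ⟨-, rfl, hy⟩ | ⟨-, hx, rfl⟩)
      · exact hle (L.adj_of_page _ _ _ h)
      · rw [hy]; exact hcu.symm
      · rw [hx]; exact hcu
    · intro x y hadj hlt
      by_cases hx : x.1 = c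
      · have hy : y.1 = u := hleaf _ (hx ▸ hadj)
        obtain ⟨y, j⟩ := y
        subst hy
        cases j
        · rcases hqc x hx with h | h <;> linarith
        · exact ⟨false, .inr (.inr ⟨rfl, hx, rfl⟩)⟩
      · by_cases hy : y.1 = c
        · have hx : x.1 = u := hleaf _ (hy ▸ hadj.symm)
          obtain ⟨x, j⟩ := x
          subst hx
          cases j
          · exact ⟨true, .inr (.inl ⟨rfl, rfl, hy⟩)⟩
          · rcases hqc y hy with h | h <;> linarith
        · rw [hq x hx, hq y hy] at hlt
          have hadj' : F'.Adj x.1 y.1 := by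
            rw [hF', deleteEdges_adj]
            refine ⟨hadj, fun h => ?_⟩
            rw [Set.mem_singleton_iff, Sym2.eq_iff] at h
            rcases h with h | h
            exacts [hx h.1, hy h.2]
          obtain ⟨i, hi⟩ := L.exists_page x y hadj' hlt
          exact ⟨i, .inl hi⟩
    · rintro i a b d e h h' h1 h2 h3
      rcases h with h | ⟨rfl, rfl, hb⟩ | ⟨rfl, ha, rfl⟩
      · rcases h' with h' | ⟨rfl, rfl, he⟩ | ⟨rfl, hd, rfl⟩
        · exact hnc i a b d e h h' h1 h2 h3
        · rcases hqc e he with h4 | h4 <;> rcases hgap b (hp2 h) with h5 | h5 <;> linarith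
        · have h6 := hpr u a b hne h
          rcases hqc d hd with h4 | h4 <;> rcases hgap b (hp2 h) with h5 | h5 <;>
            rcases hgap a (hp1 h) with h7 | h7 <;>
            first | linarith | exact h6 (by linarith) (by linarith) (by linarith)
      · rcases h' with h' | ⟨-, rfl, he⟩ | ⟨h', -, -⟩
        · rcases hqc b hb with h4 | h4 <;> rcases hgap d (hp1 h') with h5 | h5 <;> linarith
        · linarith
        · cases h'
      · rcases h' with h' | ⟨h', -, -⟩ | ⟨-, hd, rfl⟩
        · have h6 := hpl u d e hne h'
          rcases hqc a ha with h4 | h4 <;> exact h6 (by linarith) (by linarith) (by linarith)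
        · cases h'
        · linarith
    · intro v
      by_cases hv : v = c
      · subst hv; linarith
      · rw [hq _ hv, hq _ hv]
        exact L.pair_lt v
    · intro v w h1 h2 h3
      by_cases hv : v = c <;> by_cases hw : w = c
      · subst hv; subst hw; linarith
      · subst hv
        rcases hgap (w, false) hw with h5 | h5 <;> linarith
      · subst hw
        rcases hgap (v, true) hv with h5 | h5 <;> linarith
      · exact hlam v w hv hw h1 h2 h3
    · rintro v x y (h | ⟨h, -, -⟩ | ⟨-, hx, rfl⟩) h1 h2 h3
      · by_cases hv : v = c
        · subst hv
          rcases hgap y (hp2 h) with h5 | h5 <;> linarith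
        · exact hpr v x y hv h h1 h2 h3
      · cases h
      · by_cases hv : v = c
        · subst hv; linarith
        · have := hlam u v hne hv
          rcases hqc x hx with h4 | h4 <;> exact this (by linarith) (by linarith) (by linarith)
    · rintro v x y (h | ⟨h, -, -⟩ | ⟨-, hx, rfl⟩) h1 h2 h3
      · by_cases hv : v = c
        · subst hv
          rcases hgap x (hp1 h) with h5 | h5 <;> linarith
        · exact hpl v x y hv h h1 h2 h3
      · cases h
      · by_cases hv : v = c
        · subst hv
          rcases hqc x hx with h4 | h4 <;> linarith
        · have h7 := hlam v u hv hne
          have h8 : q (v, false) ≤ l := by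
            rcases hqc x hx with h4 | h4 <;> rcases hgap (v, false) hv with h5 | h5 <;> linarith
          have h9 : l + ε ≤ q x := by rcases hqc x hx with h4 | h4 <;> linarith
          rcases h8.eq_or_lt with h8 | h8
          · have : v = u := congrArg Prod.fst (hqinj (h8.trans hqu.symm))
            subst this
            linarith
          · exact h7 (by linarith) (by linarith) (by linarith)

/-- Replacing every vertex of a finite forest by at most two copies yields a planar graph. -/
theorem IsAcyclic.isPlanar_comap {V W : Type*} [Finite V] {F : SimpleGraph V}
    (hF : F.IsAcyclic) {φ : W → V × Bool} (hφ : Function.Injective φ) :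
    (F.comap fun w => (φ w).1).IsPlanar := by
  obtain ⟨L⟩ := hF.nonempty_doubledLayout
  exact isPlanar_of_two_pages (L.pos_injective.comp hφ) (fun i a b => L.page i (φ a) (φ b))
    (fun a b => L.exists_page (φ a) (φ b))
    (fun i a b c d => L.noncrossing i (φ a) (φ b) (φ c) (φ d))

/-- Adjacency is pulled back, so a triangle would map to a triangle of the forest. -/
lemma IsAcyclic.four_le_egirth_comap {V W : Type*} {F : SimpleGraph V} (hF : F.IsAcyclic)
    (π : W → V) : 4 ≤ (F.comap π).egirth := by
  classical
  rw [le_egirth]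
  intro a w hw
  have h3 := hw.three_le_length
  rcases h3.eq_or_lt with h | h
  · exfalso
    match w, h with
    | .cons h1 (.cons h2 (.cons h3 .nil)), _ =>
      exact hF.cliqueFree le_rfl _ (is3Clique_triple_iff.mpr ⟨h1, h3.symm, h2⟩)
  · exact_mod_cast h

end SimpleGraph

/-! ### Colouring vectors with independent colour classes. -/

open Submodule in
-- By uniqueness of coordinates, the elements occurring in `w` are exactly those whose removal takes
-- `w` out of the span.
lemma LinearIndepOn.mem_span_image_inter {K α W : Type*} [Field K] [AddCommGroup W] [Module K W]
    {x : α → W} {I S : Set α} (hI : LinearIndepOn K x I) {w : W} (hw : w ∈ span K (x '' I))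
    (hS : ∀ e ∈ I, w ∉ span K (x '' (I \ {e})) → e ∈ S) : w ∈ span K (x '' (I ∩ S)) := by
  obtain ⟨l, hl, rfl⟩ := (Finsupp.mem_span_image_iff_linearCombination K).mp hw
  refine (Finsupp.mem_span_image_iff_linearCombination K).mpr ⟨l, fun e he => ?_, rfl⟩
  have heI : e ∈ I := hl he
  refine ⟨heI, hS e heI fun h => ?_⟩
  obtain ⟨l', hl', heq⟩ := (Finsupp.mem_span_image_iff_linearCombination K).mp h
  have h0 := linearIndepOn_iff.mp hI (l' - l)
    (sub_mem (Finsupp.supported_mono Set.sdiff_subset hl') hl) (by rw [map_sub, heq, sub_self])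
  have hle : l' e = 0 := by
    by_contra hne
    exact (hl' (Finsupp.mem_support_iff.mpr hne)).2 rfl
  rw [sub_eq_zero] at h0
  rw [h0] at hle
  exact Finsupp.mem_support_iff.mp he hle

namespace IndependentColoring

open Submodule

variable {K α W ι : Type*} [Field K] [AddCommGroup W] [Module K W] {x : α → W}

/-- The elements of `E` other than `y` of colour `i`. -/
def colorClass (E : Set α) (c : α → ι) (y : α) (i : ι) : Set α := {e ∈ E | e ≠ y ∧ c e = i}

variable [DecidableEq α]

lemma colorClass_update_self {E : Set α} {c : α → ι} {y y' : α} (hy : y ∈ E) (hne : y' ≠ y) :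
    colorClass E (Function.update c y (c y')) y' (c y') =
      insert y (colorClass E c y (c y') \ {y'}) := by
  ext e
  by_cases h : e = y
  · subst h
    simp [colorClass, hy, hne.symm]
  · simp [colorClass, h]
    tauto

lemma colorClass_update_of_ne {E : Set α} {c : α → ι} {y y' : α} {j : ι} (hj : j ≠ c y') :
    colorClass E (Function.update c y (c y')) y' j = colorClass E c y j := by
  ext e
  by_cases h : e = y
  · subst h
    simp [colorClass, hj.symm]
  · simp only [colorClass, ne_eq, Set.mem_ofPred_eq, Function.update_of_ne h, h, not_false_eq_true,
      true_and]
    have : c e = j → e ≠ y' := by rintro rfl rfl; exact hj rfl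
    tauto

/-- From a colouring of `E` without `y` to a colouring of `E` without `y'`, by giving the colour of
`y'` to `y`. -/
def Exchange (K : Type*) [Field K] [Module K W] (x : α → W) (E : Set α)
    (s t : (α → ι) × α) : Prop :=
  t.2 ∈ E ∧ t.2 ≠ s.2 ∧ x s.2 ∉ span K (x '' (colorClass E s.1 s.2 (s.1 t.2) \ {t.2})) ∧
    t.1 = Function.update s.1 s.2 (s.1 t.2)

/-- Exchanges keep all colour classes independent and change only which element is uncoloured. If in
some reachable state the uncoloured element fits into a class, the colouring extends; otherwise the
elements that can become uncoloured form the obstruction `S`. -/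
lemma extend_or_obstruction {E : Set α} {c₀ : α → ι} {y₀ : α} (hy₀ : y₀ ∈ E)
    (h₀ : ∀ i, LinearIndepOn K x (colorClass E c₀ y₀ i)) :
    (∃ c : α → ι, ∀ i, LinearIndepOn K x {e ∈ E | c e = i}) ∨
      ∃ S ⊆ E, y₀ ∈ S ∧ ∀ i, ∀ e ∈ S, x e ∈ span K (x '' {e ∈ S | e ≠ y₀ ∧ c₀ e = i}) := by
  let R : (α → ι) × α → Prop := Relation.ReflTransGen (Exchange K x E) (c₀, y₀)
  have hvalid : ∀ s, R s → s.2 ∈ E ∧ ∀ i, LinearIndepOn K x (colorClass E s.1 s.2 i) := by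
    intro s hs
    induction hs with
    | refl => exact ⟨hy₀, h₀⟩
    | @tail s t _ hst ih =>
      obtain ⟨c, y⟩ := s
      obtain ⟨c', y'⟩ := t
      obtain ⟨hy', hne, hnot, heq⟩ := hst
      dsimp only at ih hy' hnot hne heq ⊢
      subst heq
      refine ⟨hy', fun j => ?_⟩
      by_cases hj : j = c y'
      · rw [hj, colorClass_update_self ih.1 hne]
        exact ((ih.2 _).mono Set.sdiff_subset).insert hnot
      · rw [colorClass_update_of_ne hj]
        exact ih.2 j
  by_cases hext : ∃ s, R s ∧ ∃ i, x s.2 ∉ span K (x '' colorClass E s.1 s.2 i)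
  · left
    obtain ⟨⟨c, y⟩, hs, i, hi⟩ := hext
    obtain ⟨hyE, hind⟩ := hvalid _ hs
    refine ⟨Function.update c y i, fun j => ?_⟩
    by_cases hj : j = i
    · subst hj
      refine ((hind j).insert hi).mono fun e he => ?_
      by_cases hey : e = y
      · exact .inl hey
      · exact .inr ⟨he.1, hey, by simpa [hey] using he.2⟩
    · refine (hind j).mono fun e he => ?_
      have hey : e ≠ y := by
        rintro rfl
        exact hj (by simpa using he.2.symm)
      exact ⟨he.1, hey, by simpa [hey] using he.2⟩
  · right
    push Not at hext
    let S : Set α := {y | ∃ c, R (c, y)}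
    have hSpan : ∀ s, R s → ∀ i, x s.2 ∈ span K (x '' (colorClass E s.1 s.2 i ∩ S)) := by
      intro s hs i
      refine ((hvalid s hs).2 i).mem_span_image_inter (hext s hs i) fun e he hnot => ?_
      have hc : s.1 e = i := he.2.2
      exact ⟨_, hs.tail (c := (Function.update s.1 s.2 (s.1 e), e))
        ⟨he.1, he.2.1, by rwa [hc], rfl⟩⟩
    -- By Steinitz exchange, swapping `y'` for `y` preserves the span of each class within `S`, so
    -- spanning in any reachable state transfers to the initial colouring.
    have hinv : ∀ s, R s → ∀ i, span K (x '' (colorClass E s.1 s.2 i ∩ S)) =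
        span K (x '' (colorClass E c₀ y₀ i ∩ S)) := by
      intro s hs
      induction hs with
      | refl => exact fun _ => rfl
      | @tail s t hs hst ih =>
        intro i
        rw [← ih]
        have ht : R t := hs.tail hst
        have hsE := (hvalid s hs).1
        have hsp := hSpan s hs i
        obtain ⟨c, y⟩ := s
        obtain ⟨c', y'⟩ := t
        obtain ⟨hy', hne, hnot, heq⟩ := hst
        dsimp only at hy' hnot hne hsE hsp heq ⊢
        subst heq
        by_cases hi : i = c y'
        · subst hi
          have hyS : y ∈ S := ⟨_, hs⟩
          have hy'S : y' ∈ S := ⟨_, ht⟩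
          have hy'c : y' ∈ colorClass E c y (c y') ∩ S := ⟨⟨hy', hne, rfl⟩, hy'S⟩
          set A := colorClass E c y (c y') ∩ S with hA
          have hA' : insert y' (A \ {y'}) = A := by simp [hy'c]
          have hB : colorClass E (Function.update c y (c y')) y' (c y') ∩ S =
              insert y (A \ {y'}) := by
            rw [colorClass_update_self hsE hne, Set.insert_inter_of_mem hyS, hA,
              ← Set.inter_sdiff_right_comm]
          have hnot' : x y ∉ span K (x '' (A \ {y'})) := fun h =>
            hnot (span_mono (Set.image_mono (Set.sdiff_subset_sdiff_left Set.inter_subset_left)) h)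
          rw [hB, Set.image_insert_eq]
          apply le_antisymm <;> rw [span_le]
          · rintro _ (rfl | ⟨e, he, rfl⟩)
            · exact hsp
            · exact subset_span ⟨e, he.1, rfl⟩
          · rintro _ ⟨e, he, rfl⟩
            by_cases hee : e = y'
            · subst hee
              refine mem_span_insert_exchange ?_ hnot'
              rwa [← Set.image_insert_eq, hA']
            · exact subset_span (.inr ⟨e, ⟨he, hee⟩, rfl⟩)
        · rw [colorClass_update_of_ne hi]
    refine ⟨S, ?_, ⟨c₀, .refl⟩, ?_⟩
    · rintro y ⟨c, hc⟩
      exact (hvalid _ hc).1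
    · rintro i y ⟨c, hc⟩
      have h := hSpan _ hc i
      rw [hinv _ hc i] at h
      refine span_mono (Set.image_mono ?_) h
      rintro e ⟨⟨-, he⟩, heS⟩
      exact ⟨heS, he⟩

/-- A finite family of vectors can be coloured with linearly independent colour classes, unless
there is a subfamily `S` spanned, even after the removal of one vector, by each of the colour
classes of some colouring of `S`. -/
theorem exists_or_obstruction (K : Type*) [Field K] [Module K W] [Finite α] [Nonempty ι]
    (x : α → W) :
    (∃ c : α → ι, ∀ i, LinearIndepOn K x {e | c e = i}) ∨
      ∃ (S : Set α) (y : α) (c : α → ι), y ∈ S ∧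
        ∀ i, ∀ e ∈ S, x e ∈ span K (x '' {e ∈ S | e ≠ y ∧ c e = i}) := by
  suffices h : ∀ E : Set α, (∃ c : α → ι, ∀ i, LinearIndepOn K x {e ∈ E | c e = i}) ∨
      ∃ (S : Set α) (y : α) (c : α → ι), y ∈ S ∧
        ∀ i, ∀ e ∈ S, x e ∈ span K (x '' {e ∈ S | e ≠ y ∧ c e = i}) by
    simpa using h Set.univ
  intro E
  induction E, E.toFinite using Set.Finite.induction_on with
  | empty => exact .inl ⟨fun _ => Classical.arbitrary ι, fun i => by simp⟩
  | @insert y E hy _ ih =>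
    rcases ih with ⟨c, hc⟩ | h
    · have hcls : ∀ i, colorClass (insert y E) c y i = {e ∈ E | c e = i} := by
        intro i
        ext e
        simp only [colorClass, Set.mem_insert_iff, ne_eq, Set.mem_ofPred_eq]
        have : e ∈ E → e ≠ y := fun h h' => hy (h' ▸ h)
        tauto
      rcases extend_or_obstruction (K := K) (x := x) (Set.mem_insert y E)
        (fun i => by rw [hcls]; exact hc i) with h | ⟨S, -, hyS, hS⟩
      · exact .inl h
      · exact .inr ⟨S, y, c, hyS, hS⟩
    · exact .inr h

end IndependentColoring

/-! ### Edge vectors modulo two and Nash-Williams' theorem. -/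

namespace SimpleGraph

open Submodule

variable {V : Type*}

/-- The vector of an edge over the field with two elements: the sum of its two ends. -/
noncomputable def edgeVector (e : Sym2 V) : V →₀ ZMod 2 :=
  Sym2.lift ⟨fun a b => Finsupp.single a 1 + Finsupp.single b 1, fun _ _ => add_comm _ _⟩ e

@[simp] lemma edgeVector_mk (a b : V) :
    edgeVector s(a, b) = Finsupp.single a 1 + Finsupp.single b 1 := rfl

lemma single_one_add_self (a : V) :
    (Finsupp.single a 1 + Finsupp.single a 1 : V →₀ ZMod 2) = 0 := by
  rw [← Finsupp.single_add, CharTwo.add_self_eq_zero, Finsupp.single_zero]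

lemma single_add_single_mem_span_of_reachable {H : SimpleGraph V} {a b : V}
    (h : H.Reachable a b) : (Finsupp.single a 1 + Finsupp.single b 1 : V →₀ ZMod 2) ∈
      span (ZMod 2) (edgeVector '' H.edgeSet) := by
  obtain ⟨w⟩ := h
  induction w with
  | nil => rw [single_one_add_self]; exact zero_mem _
  | @cons a b c hadj _ ih =>
    have h1 : edgeVector s(a, b) ∈ span (ZMod 2) (edgeVector '' H.edgeSet) :=
      subset_span ⟨_, hadj, rfl⟩
    have h2 := add_mem h1 ih
    rw [edgeVector_mk] at h2
    have h3 : (Finsupp.single a 1 + Finsupp.single b 1 +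
        (Finsupp.single b 1 + Finsupp.single c 1) : V →₀ ZMod 2) =
        Finsupp.single a 1 + Finsupp.single c 1 +
          (Finsupp.single b 1 + Finsupp.single b 1) := by abel
    rwa [h3, single_one_add_self, add_zero] at h2

/-- The sum of the coordinates over the component of `u` vanishes on the edges in `S`, but equals 1
on `s(u, v)` when `v` lies outside that component. -/
lemma reachable_of_edgeVector_mem_span {S : Set (Sym2 V)} {u v : V}
    (h : edgeVector s(u, v) ∈ span (ZMod 2) (edgeVector '' S)) :
    (fromEdgeSet S).Reachable u v := by
  classical
  let φ : (V →₀ ZMod 2) →ₗ[ZMod 2] ZMod 2 := Finsupp.linearCombination (ZMod 2)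
    fun w => if (fromEdgeSet S).Reachable u w then (1 : ZMod 2) else 0
  have hφ : span (ZMod 2) (edgeVector '' S) ≤ LinearMap.ker φ := by
    rw [span_le]
    rintro _ ⟨e, he, rfl⟩
    induction e using Sym2.ind with | _ a b
    have hab : (fromEdgeSet S).Reachable u a ↔ (fromEdgeSet S).Reachable u b := by
      by_cases hne : a = b
      · rw [hne]
      · have hadj : (fromEdgeSet S).Adj a b := (fromEdgeSet_adj _).mpr ⟨he, hne⟩
        exact ⟨fun h => h.trans hadj.reachable, fun h => h.trans hadj.symm.reachable⟩
    simp only [SetLike.mem_coe, LinearMap.mem_ker, edgeVector_mk, map_add, φ,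
      Finsupp.linearCombination_single, hab]
    rw [CharTwo.add_self_eq_zero]
  have h0 := hφ h
  by_contra hn
  simp [φ, edgeVector_mk, hn] at h0

lemma isAcyclic_fromEdgeSet_of_linearIndepOn {S : Set (Sym2 V)}
    (hS : LinearIndepOn (ZMod 2) edgeVector S) : (fromEdgeSet S).IsAcyclic := by
  rw [isAcyclic_iff_forall_adj_isBridge]
  intro u v hadj
  rw [isBridge_iff]
  intro hr
  have hmem : s(u, v) ∈ S := ((fromEdgeSet_adj _).mp hadj).1
  refine hS.notMem_span hmem (span_mono (Set.image_mono ?_)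
    (single_add_single_mem_span_of_reachable hr))
  rw [edgeSet_deleteEdges, edgeSet_fromEdgeSet]
  exact Set.sdiff_subset_sdiff_left Set.sdiff_subset

lemma Reachable.of_forall_adj {H H' : SimpleGraph V} {a b : V} (h : H.Reachable a b)
    (hadj : ∀ a b, H.Adj a b → H'.Reachable a b) : H'.Reachable a b := by
  obtain ⟨w⟩ := h
  induction w with
  | nil => exact Reachable.refl _
  | cons h _ ih => exact (hadj _ _ h).trans ih

lemma ncard_le_ncard_edges_add_one_of_reachable [Finite V] {S : Set (Sym2 V)} {C : Set V} {u : V}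
    (hC : C = {w | (fromEdgeSet S).Reachable u w}) :
    C.ncard ≤ {e ∈ S | ∀ w ∈ e, w ∈ C}.ncard + 1 := by
  set c := (fromEdgeSet S).connectedComponentMk u
  have hcC : c.supp = C := by
    ext w
    rw [hC, ConnectedComponent.mem_supp_iff, ConnectedComponent.eq]
    exact ⟨fun h => h.symm, fun h => h.symm⟩
  have h := c.connected_toSimpleGraph.card_vert_le_card_edgeSet_add_one
  have h1 : Nat.card c = C.ncard := by rw [← hcC]; rfl
  rw [h1, Nat.card_coe_set_eq] at h
  refine h.trans (Nat.add_le_add_right ?_ 1)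
  rw [← Set.ncard_image_of_injective c.toSimpleGraph.edgeSet
    (Sym2.map.injective (Subtype.val_injective (p := (· ∈ c.supp))))]
  refine Set.ncard_le_ncard ?_ (Set.toFinite _)
  rintro _ ⟨e, he, rfl⟩
  induction e using Sym2.ind with | _ a b
  have hadj : (fromEdgeSet S).Adj a b := he
  refine ⟨((fromEdgeSet_adj _).mp hadj).1, fun w hw => ?_⟩
  obtain ⟨w', -, rfl⟩ := Sym2.mem_map.mp hw
  rw [← hcC]
  exact w'.2

/-- **Nash-Williams' theorem** on the arboricity of a graph: if every nonempty set of `s` vertices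
spans at most `k (s - 1)` edges, then the graph is a union of `k` forests. -/
theorem exists_isAcyclic_iSup_eq [Finite V] (G : SimpleGraph V) (k : ℕ)
    (hG : ∀ C : Set V, C.Nonempty → {e ∈ G.edgeSet | ∀ w ∈ e, w ∈ C}.ncard + k ≤ k * C.ncard) :
    ∃ F : Fin k → SimpleGraph V, (∀ i, F i ≤ G ∧ (F i).IsAcyclic) ∧ ⨆ i, F i = G := by
  classical
  rcases Nat.eq_zero_or_pos k with rfl | hk
  · refine ⟨fun _ => ⊥, fun i => i.elim0, ?_⟩
    rw [iSup_of_empty, eq_comm, ← edgeSet_eq_empty, Set.eq_empty_iff_forall_notMem]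
    intro e he
    induction e using Sym2.ind with | _ a b
    have := hG Set.univ ⟨a, trivial⟩
    rw [add_zero, zero_mul, Nat.le_zero, Set.ncard_eq_zero (Set.toFinite _)] at this
    exact Set.eq_empty_iff_forall_notMem.mp this s(a, b) ⟨he, fun _ _ => trivial⟩
  have : Nonempty (Fin k) := ⟨⟨0, hk⟩⟩
  rcases IndependentColoring.exists_or_obstruction (ι := Fin k) (ZMod 2)
    (fun e : G.edgeSet => edgeVector (e : Sym2 V)) with ⟨c, hc⟩ | ⟨S, y, c, hyS, hS⟩
  · have hsub : ∀ i, (fromEdgeSet (Subtype.val '' {e | c e = i})) ≤ G := by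
      intro i a b h
      obtain ⟨⟨⟨e, he⟩, -, rfl⟩, -⟩ := (fromEdgeSet_adj _).mp h
      exact he
    refine ⟨fun i => fromEdgeSet (Subtype.val '' {e | c e = i}), fun i => ⟨hsub i,
      isAcyclic_fromEdgeSet_of_linearIndepOn ((hc i).image_of_comp Subtype.val edgeVector)⟩,
      le_antisymm (iSup_le hsub) fun a b h => ?_⟩
    rw [iSup_adj]
    exact ⟨c ⟨s(a, b), h⟩, (fromEdgeSet_adj _).mpr ⟨⟨_, rfl, rfl⟩, h.ne⟩⟩
  · exfalso
    set I : Fin k → Set (Sym2 V) := fun i => Subtype.val '' {e ∈ S | e ≠ y ∧ c e = i} with hI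
    obtain ⟨u, hu⟩ : ∃ u, u ∈ (y : Sym2 V) := by
      induction (y : Sym2 V) using Sym2.ind with | _ a b
      exact ⟨a, by simp⟩
    set C : Set V := {w | (fromEdgeSet (Subtype.val '' S)).Reachable u w} with hC
    -- Every colour class spans all of `S`, so each one connects the whole component `C` and has at
    -- least `|C| - 1` edges in it. The uncoloured edge `y` is one more, which exceeds the allowed
    -- density.
    have hCi : ∀ i, C = {w | (fromEdgeSet (I i)).Reachable u w} := by
      intro i
      refine Set.Subset.antisymm (fun w hw => hw.of_forall_adj fun a b hab => ?_) fun w hw =>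
        hw.mono (fromEdgeSet_mono (Set.image_mono fun e he => he.1))
      obtain ⟨⟨e, he, hee⟩, -⟩ := (fromEdgeSet_adj _).mp hab
      refine reachable_of_edgeVector_mem_span ?_
      have := hS i e he
      rw [hee] at this
      rwa [hI, Set.image_image]
    set D : Fin k → Set (Sym2 V) := fun i => {e ∈ I i | ∀ w ∈ e, w ∈ C}
    have hD : ∀ i, C.ncard ≤ (D i).ncard + 1 := fun i =>
      ncard_le_ncard_edges_add_one_of_reachable (hCi i)
    set N : Set (Sym2 V) := {e ∈ G.edgeSet | ∀ w ∈ e, w ∈ C}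
    have hyN : (y : Sym2 V) ∈ N := by
      refine ⟨y.2, fun w hw => ?_⟩
      by_cases huw : u = w
      · subst huw; exact Reachable.refl u
      · refine Adj.reachable ((fromEdgeSet_adj _).mpr ⟨⟨y, hyS, ?_⟩, huw⟩)
        exact (Sym2.mem_and_mem_iff huw).mp ⟨hu, hw⟩
    have hsum : ∑ i, (D i).ncard + 1 ≤ N.ncard := by
      have h1 : ∀ i, (D i).ncard = (D i).toFinite.toFinset.card := fun i =>
        Set.ncard_eq_toFinset_card _
      rw [Finset.sum_congr rfl fun i _ => h1 i, ← Finset.card_biUnion, Set.ncard_eq_toFinset_card N,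
        ← Finset.card_erase_add_one (s := N.toFinite.toFinset) (a := (y : Sym2 V)) (by simpa)]
      · refine Nat.add_le_add_right (Finset.card_le_card fun e he => ?_) 1
        simp only [Finset.mem_biUnion, Finset.mem_univ, Set.Finite.mem_toFinset, true_and] at he
        obtain ⟨i, ⟨e, ⟨-, hey, -⟩, rfl⟩, heC⟩ := he
        rw [Finset.mem_erase, Set.Finite.mem_toFinset]
        exact ⟨fun h => hey (Subtype.ext h), e.2, heC⟩
      · intro i _ j _ hij
        simp only [Finset.disjoint_left, Set.Finite.mem_toFinset]
        rintro _ ⟨⟨e, ⟨-, -, hi⟩, rfl⟩, -⟩ ⟨⟨e', ⟨-, -, hj⟩, he⟩, -⟩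
        rw [Subtype.ext he] at hj
        exact hij (hi.symm.trans hj)
    have hk' : k * C.ncard ≤ ∑ i, (D i).ncard + k := by
      have := Finset.sum_le_sum fun (i : Fin k) (_ : i ∈ Finset.univ) => hD i
      simpa [Finset.sum_add_distrib] using this
    have : N.ncard + k ≤ k * C.ncard := hG C ⟨u, Reachable.refl u⟩
    omega

end SimpleGraph

/-! ### Edge counts in complete multipartite graphs. -/

namespace SimpleGraph

open Finset

lemma two_mul_ncard_edges_within {V : Type*} [DecidableEq V] (G : SimpleGraph V)
    [DecidableRel G.Adj] (C : Finset V) :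
    2 * {e ∈ G.edgeSet | ∀ w ∈ e, w ∈ C}.ncard = #{p ∈ C ×ˢ C | G.Adj p.1 p.2} := by
  set P := {p ∈ C ×ˢ C | G.Adj p.1 p.2} with hP
  have himg : {e ∈ G.edgeSet | ∀ w ∈ e, w ∈ C} = (P.image fun p => s(p.1, p.2) : Finset _) := by
    ext e
    induction e using Sym2.ind with | _ a b
    simp only [Set.mem_ofPred_eq, mem_edgeSet, Sym2.mem_iff, forall_eq_or_imp, forall_eq,
      coe_image, Set.mem_image, SetLike.mem_coe, hP, mem_filter, mem_product, Prod.exists]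
    constructor
    · rintro ⟨h, ha, hb⟩
      exact ⟨a, b, ⟨⟨ha, hb⟩, h⟩, rfl⟩
    · rintro ⟨x, y, ⟨⟨hx, hy⟩, h⟩, he⟩
      rcases Sym2.eq_iff.mp he with ⟨rfl, rfl⟩ | ⟨rfl, rfl⟩
      exacts [⟨h, hx, hy⟩, ⟨h.symm, hy, hx⟩]
  rw [himg, Set.ncard_coe_finset, card_eq_sum_card_image (fun p : V × V => s(p.1, p.2)) P,
    sum_const_nat (m := 2), mul_comm]
  intro e he
  obtain ⟨⟨a, b⟩, hab, rfl⟩ := mem_image.mp he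
  simp only [hP, mem_filter, mem_product] at hab
  have : {p ∈ P | s(p.1, p.2) = s(a, b)} = {(a, b), (b, a)} := by
    ext ⟨x, y⟩
    simp only [hP, mem_filter, mem_product, mem_insert, mem_singleton, Prod.mk.injEq, Sym2.eq_iff]
    constructor
    · exact fun h => h.2
    · rintro (⟨rfl, rfl⟩ | ⟨rfl, rfl⟩)
      · exact ⟨hab, .inl ⟨rfl, rfl⟩⟩
      · exact ⟨⟨⟨hab.1.2, hab.1.1⟩, hab.2.symm⟩, .inr ⟨rfl, rfl⟩⟩
  rw [this, card_pair]
  rintro h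
  exact hab.2.ne (congrArg Prod.fst h)

section Multipartite

variable {V ι : Type*} [DecidableEq ι] (π : V → ι)

/-- The number of ordered pairs of elements of `C` in different fibres of `π`. -/
def crossPairs (C : Finset V) : ℕ := #{p ∈ C ×ˢ C | π p.1 ≠ π p.2}

lemma crossPairs_eq_sum (C : Finset V) :
    crossPairs π C = ∑ a ∈ C, #{b ∈ C | π b ≠ π a} := by
  rw [crossPairs, card_filter, sum_product]
  simp_rw [card_filter, ne_comm]

lemma crossPairs_insert [DecidableEq V] {C : Finset V} {v : V} (hv : v ∉ C) :
    crossPairs π (insert v C) = crossPairs π C + 2 * #{b ∈ C | π b ≠ π v} := by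
  simp_rw [crossPairs_eq_sum, card_filter, sum_insert hv, sum_add_distrib]
  simp only [ne_eq, not_true_eq_false, if_false, zero_add]
  have : ∑ a ∈ C, (if ¬ π v = π a then 1 else 0) = ∑ a ∈ C, if ¬ π a = π v then 1 else 0 :=
    sum_congr rfl fun a _ => by simp only [eq_comm]
  rw [this]
  ring

/-- Let `d` vertices of `C` lie outside the part of `v`. The other `#C - d` have `d` partners each,
and these `d` have at most `#C - 1` each; for `d ≥ 1` the total is at most `2d(#C - 1)`, and for `d
= 0` it is zero. -/
lemma crossPairs_add_le (C : Finset V) (v : V) :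
    crossPairs π C + 2 * #{b ∈ C | π b ≠ π v} ≤ 2 * #C * #{b ∈ C | π b ≠ π v} := by
  set d := #{b ∈ C | π b ≠ π v} with hd
  have hx : #{b ∈ C | π b = π v} + d = #C := card_filter_add_card_filter_not _
  have h1 : ∑ a ∈ C with π a = π v, #{b ∈ C | π b ≠ π a} = #{b ∈ C | π b = π v} * d := by
    rw [sum_const_nat]
    intro a ha
    rw [(mem_filter.mp ha).2]
  have h2 : ∑ a ∈ C with π a ≠ π v, (#{b ∈ C | π b ≠ π a} + 1) ≤ d * #C := by
    refine (sum_le_card_nsmul _ _ (#C) fun a ha => ?_).trans_eq (smul_eq_mul _ _)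
    refine Nat.succ_le_of_lt (card_lt_card (filter_ssubset.mpr ⟨a, (mem_filter.mp ha).1, by simp⟩))
  have h3 := sum_filter_add_sum_filter_not C (fun a => π a = π v) fun a => #{b ∈ C | π b ≠ π a}
  rw [← crossPairs_eq_sum, h1] at h3
  rw [sum_add_distrib, sum_const, smul_eq_mul, mul_one] at h2
  rcases Nat.eq_zero_or_pos d with h0 | h0
  · rw [h0] at h2 h3 ⊢
    simp only [ne_eq] at h2 h3
    omega
  · simp only [ne_eq] at h2 h3 hd
    rw [← hd] at h2
    nlinarith

lemma crossPairs_le_of_univ [Fintype V] [DecidableEq V] {k : ℕ}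
    (hk : crossPairs π univ + 2 * k ≤ 2 * k * Fintype.card V) (C : Finset V) (hC : C.Nonempty) :
    crossPairs π C + 2 * k ≤ 2 * k * #C := by
  induction hn : #Cᶜ generalizing C with
  | zero =>
    rw [card_eq_zero, compl_eq_empty_iff] at hn
    subst hn
    exact hk
  | succ n ih =>
    obtain ⟨v, hv⟩ : Cᶜ.Nonempty := card_pos.mp (by omega)
    have hvC : v ∉ C := mem_compl.mp hv
    have h1 := ih (insert v C) (insert_nonempty _ _) (by
      rw [compl_insert, card_erase_of_mem hv, hn, Nat.add_sub_cancel])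
    rw [crossPairs_insert π hvC, card_insert_of_notMem hvC] at h1
    have h2 := crossPairs_add_le π C v
    have hc : 0 < #C := card_pos.mpr hC
    set d := #{b ∈ C | π b ≠ π v}
    set N := crossPairs π C
    obtain ⟨c, hc'⟩ : ∃ c, #C = c + 1 := ⟨#C - 1, by omega⟩
    rw [hc'] at h1 h2 ⊢
    have h3 : N + 2 * d ≤ 2 * k * (c + 1) := by linarith
    have h4 : N ≤ 2 * c * d := by linarith
    -- The density bound descends on removing `v`: `(c + 1)N ≤ cN + 2cd = c(N + 2d) ≤ 2kc(c + 1)`.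
    have h5 : (c + 1) * N ≤ (c + 1) * (2 * k * c) := by nlinarith [Nat.mul_le_mul_left c h3]
    have := Nat.le_of_mul_le_mul_left h5 (by omega)
    linarith

end Multipartite

lemma crossPairs_sigma {m : ℕ} (f : Fin m → ℕ) :
    crossPairs (Sigma.fst : (Σ i, Fin (f i)) → Fin m) univ =
      2 * ∑ i, ∑ j ∈ Ioi i, f i * f j := by
  have h1 : crossPairs (Sigma.fst : (Σ i, Fin (f i)) → Fin m) univ =
      ∑ i, ∑ j, if j ≠ i then f i * f j else 0 := by
    rw [crossPairs_eq_sum]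
    simp only [card_filter, Fintype.sum_sigma]
    refine sum_congr rfl fun i _ => ?_
    trans ∑ x : Fin (f i), ∑ j, if j ≠ i then f j else 0
    · refine sum_congr rfl fun x _ => sum_congr rfl fun j _ => ?_
      by_cases h : j = i <;> simp [h]
    · rw [sum_const, card_univ, Fintype.card_fin, smul_eq_mul, mul_sum]
      simp_rw [mul_ite, mul_zero]
  have h2 : ∀ i j : Fin m, (if j ≠ i then f i * f j else 0) =
      (if i < j then f i * f j else 0) + if j < i then f j * f i else 0 := by
    intro i j
    rcases lt_trichotomy i j with h | h | h
    · simp [h, h.ne', h.not_gt]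
    · simp [h]
    · simp [h, h.ne, h.not_gt, mul_comm]
  have h3 : ∀ i : Fin m, ∑ j ∈ Ioi i, f i * f j = ∑ j, if i < j then f i * f j else 0 := by
    intro i
    rw [← sum_filter]
    congr 1
    ext; simp
  simp_rw [h1, h2, sum_add_distrib, h3]
  rw [sum_comm (f := fun i j => if j < i then f j * f i else 0), two_mul]

lemma ncard_edges_within_completeMultipartiteGraph {m : ℕ} (f : Fin m → ℕ)
    (C : Finset (Σ i, Fin (f i))) :
    2 * {e ∈ (completeMultipartiteGraph fun i => Fin (f i)).edgeSet | ∀ w ∈ e, w ∈ C}.ncard =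
      crossPairs Sigma.fst C := by
  classical
  rw [two_mul_ncard_edges_within, crossPairs]
  rfl

lemma ncard_edgeSet_completeMultipartiteGraph {m : ℕ} (f : Fin m → ℕ) :
    (completeMultipartiteGraph fun i => Fin (f i)).edgeSet.ncard =
      ∑ i, ∑ j ∈ Ioi i, f i * f j := by
  have h := ncard_edges_within_completeMultipartiteGraph f univ
  rw [crossPairs_sigma] at h
  simpa using h

/-- The complete multipartite graph with parts of sizes `n i` is a union of `k` forests as soon
as its number of edges permits this. -/
lemma exists_isAcyclic_iSup_eq_completeMultipartiteGraph {m k : ℕ} (n : Fin m → ℕ)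
    (h : ∑ i, ∑ j ∈ Ioi i, n i * n j + k ≤ k * ∑ i, n i) :
    ∃ F : Fin k → SimpleGraph (Σ i, Fin (n i)),
      (∀ i, (F i).IsAcyclic) ∧ ⨆ i, F i = completeMultipartiteGraph fun i => Fin (n i) := by
  classical
  obtain ⟨F, hF, hsup⟩ := exists_isAcyclic_iSup_eq
    (completeMultipartiteGraph fun i => Fin (n i)) k (fun C hC => by
      have h1 := crossPairs_le_of_univ (Sigma.fst : (Σ i, Fin (n i)) → Fin m) (k := k) (by
        rw [crossPairs_sigma, Fintype.card_sigma]
        simp only [Fintype.card_fin]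
        linarith) C.toFinset (by simpa using hC)
      have h2 := ncard_edges_within_completeMultipartiteGraph n C.toFinset
      simp only [Set.mem_toFinset] at h2
      rw [← h2, ← Set.ncard_eq_toFinset_card'] at h1
      linarith)
  exact ⟨F, fun i => (hF i).2, hsup⟩

lemma isUnionOfPlanarGirth_completeMultipartiteGraph {m k : ℕ} (n : Fin m → ℕ)
    (h : ∑ i, ∑ j ∈ Ioi i, n i * n j + k ≤ k * ∑ i, n i) :
    (completeMultipartiteGraph fun i => Fin (2 * n i)).IsUnionOfPlanarGirth 4 k := by
  obtain ⟨F, hF, hsup⟩ := exists_isAcyclic_iSup_eq_completeMultipartiteGraph n h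
  -- Identifies each doubled part with two copies of the original part, so that the large graph is
  -- the pullback of the small one.
  let φ : (Σ i, Fin (2 * n i)) → (Σ i, Fin (n i)) × Bool := fun w =>
    (⟨w.1, (finProdFinEquiv.symm w.2).2⟩, finTwoEquiv (finProdFinEquiv.symm w.2).1)
  have hφ : Function.Injective φ := by
    rintro ⟨i, x⟩ ⟨j, y⟩ hxy
    obtain ⟨h1, h2⟩ := Prod.ext_iff.mp hxy
    obtain ⟨rfl, h1⟩ := Sigma.mk.inj h1
    have := finProdFinEquiv.symm.injective (Prod.ext (finTwoEquiv.injective h2) (eq_of_heq h1))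
    exact congrArg (Sigma.mk i) this
  have hG : (completeMultipartiteGraph fun i => Fin (2 * n i)) =
      (⨆ i, F i).comap fun w => (φ w).1 := by
    rw [hsup]
    rfl
  have hsup' : ⨆ i, (F i).comap (fun w => (φ w).1) = (⨆ i, F i).comap fun w => (φ w).1 := by
    ext a b
    simp
  refine ⟨fun i => (F i).comap fun w => (φ w).1, fun i => ⟨?_, (hF i).isPlanar_comap hφ,
    (hF i).four_le_egirth_comap _⟩, hsup'.trans hG.symm⟩
  rw [hG, ← hsup']
  exact le_iSup (fun i => (F i).comap fun w => (φ w).1) i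

lemma IsUnionOfPlanarGirth.ncard_edgeSet_le {V : Type*} [Finite V] {G : SimpleGraph V} {k : ℕ}
    (h : G.IsUnionOfPlanarGirth 4 k) (hV : 3 ≤ Nat.card V) :
    G.edgeSet.ncard + 4 * k ≤ k * (2 * Nat.card V) := by
  obtain ⟨H, hH, rfl⟩ := h
  have h1 : ∀ i, (H i).edgeSet.ncard + 4 ≤ 2 * Nat.card V := fun i =>
    (hH i).2.1.ncard_edgeSet_add_four_le (hH i).2.2 hV
  have h2 : (⨆ i, H i).edgeSet.ncard ≤ ∑ i, (H i).edgeSet.ncard := by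
    rw [edgeSet_iSup]
    simpa using Finset.set_ncard_biUnion_le univ fun i => (H i).edgeSet
  have h3 := sum_le_sum fun (i : Fin k) (_ : i ∈ univ) => h1 i
  simp only [sum_add_distrib, sum_const, card_univ, Fintype.card_fin, smul_eq_mul] at h3
  linarith

end SimpleGraph

/-! ### The thickness formula. -/

theorem theorem2 (m : ℕ) (n : Fin m → ℕ) (hn : 2 ≤ ∑ i, n i) :
    SimpleGraph.girthThickness 4
        (SimpleGraph.completeMultipartiteGraph (fun i : Fin m => Fin (2 * n i))) =
      (⌈((∑ i, ∑ j ∈ Finset.Ioi i, n i * n j : ℕ) : ℚ) / (((∑ i, n i : ℕ) : ℚ) - 1)⌉₊ : ℕ∞) := by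
  set e := ∑ i, ∑ j ∈ Finset.Ioi i, n i * n j with he
  set N := ∑ i, n i with hN
  have hN1 : (0 : ℚ) < (N : ℚ) - 1 := by
    have : (2 : ℚ) ≤ N := by exact_mod_cast hn
    linarith
  apply le_antisymm
  · refine iInf₂_le _ (SimpleGraph.isUnionOfPlanarGirth_completeMultipartiteGraph n ?_)
    have h := Nat.le_ceil ((e : ℚ) / ((N : ℚ) - 1))
    rw [div_le_iff₀ hN1] at h
    rw [← he, ← hN]
    have h' : (e : ℚ) + (⌈(e : ℚ) / ((N : ℚ) - 1)⌉₊ : ℕ) ≤ (⌈(e : ℚ) / ((N : ℚ) - 1)⌉₊ : ℕ) * N := by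
      linarith
    exact_mod_cast h'
  · refine le_iInf₂ fun k hk => ?_
    rw [Nat.cast_le, Nat.ceil_le, div_le_iff₀ hN1]
    have hcard : Nat.card (Σ i, Fin (2 * n i)) = 2 * N := by
      rw [Nat.card_eq_fintype_card, Fintype.card_sigma]
      simp [hN, Finset.mul_sum]
    -- There are `2N ≥ 4` vertices and `4e` edges, so this reads `4e + 4k ≤ 4kN`.
    have h := hk.ncard_edgeSet_le (by omega)
    rw [SimpleGraph.ncard_edgeSet_completeMultipartiteGraph, hcard] at h
    have h4 : ∑ i, ∑ j ∈ Finset.Ioi i, 2 * n i * (2 * n j) = 4 * e := by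
      simp only [he, Finset.mul_sum]
      exact Finset.sum_congr rfl fun i _ => Finset.sum_congr rfl fun j _ => by ring
    rw [h4] at h
    have h' : (4 * e + 4 * k : ℚ) ≤ k * (2 * (2 * N)) := by exact_mod_cast h
    linarith
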